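/- **Theorem (Material derivative).** *Moving surface.* Let $Z=Z(t,y^1,y^2)\in\mathbb R^3$ be a smooth parametrization ("observer parametrization") of a patch of a moving surface, defined for $(t,y)$ in an open set $U\subset\mathbb R\times\mathbb R^2$, with $\partial_1Z,\partial_2Z$ linearly independent, and let $N$ be a smooth unit normal field. Spatial indices $i,j,k,l$ run over $1,2$ and spacetime indices $I,J,K$ over $t,1,2$. Put $g_{ij}=\langle\partial_iZ,\partial_jZ\rangle$ and $I\!I_{ij}=\langle\partial_i\partial_jZ,N\rangle$, let $\Gamma^k_{ij}$ be the Christoffel symbols of $g$, and write $\nabla$ or $|$ for the corresponding spatial covariant derivative at fixed $t$; spatial indices are raised with $g^{ij}$. Decompose the observer velocity as $\partial_tZ=v^i\partial_iZ+\nu N$ and put $\zeta=1/(1+\nu^2)$. Let $v_{\mathfrak m}=(v_{\mathfrak m}^i)$ be a smooth tangential field (the tangential material velocity), and put $u=v_{\mathfrak m}-v$, $\dot f=\partial_tf+u^k\partial_kf$ for scalar fields $f$, $$(b_{\mathfrak m})_k=\partial_k\nu+I\!I_{kj}v_{\mathfrak m}^j,\qquad \mathcal B^i{}_k=v^i{}_{|k}-\nu\,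 I\!I^i{}_k .$$ *Spacetime surface.* Let $X=(t,Z)\in\mathbb R^4$ parametrize the spacetime surface $\mathcal M$, with the metric $\eta_{IJ}=\langle\partial_IX,\partial_JX\rangle$ and its Levi-Civita covariant derivative $;$. Let $\tau=\partial_tX-v^i\partial_iX$ be the transversal direction and $\tau_{\mathfrak m}=\partial_tX+u^i\partial_iX$ the material direction. The tangent spaces of $\mathcal M$ are the orthogonal sum of $\mathbb R\tau$ (transversal) and $\operatorname{span}(\partial_1X,\partial_2X)$ (instantaneous). *Shuffles.* For $0\le\alpha\le n$ let $\mathrm{Sh}(n,\alpha)$ be the set of permutations $\sigma$ of $\{1,\dots,n\}$ with $\sigma(1)<\dots<\sigma(\alpha)$ and $\sigma(\alpha+1)<\dots<\sigma(n)$. The slots $\sigma(1),\dots,\sigma(\alpha)$ are called transversal and the other slots instantaneous. For $1\le\beta\le\alpha$ let $\sigma^\beta\in\mathrm{Sh}(n,\alpha-1)$ be the shuffle obtained by making the slot $\sigma(\beta)$ instantaneous, and for $1\le\beta\le n-\alpha$ let $\sigma_\beta\in\mathrm{Sh}(n,\alpha+1)$ be the shuffle obtained by making the slot $\sigma(\alpha+\beta)$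 transversal. Define $\bar\beta$ by $(\sigma^\beta)_{\bar\beta}=\sigma$. *Decomposition.* Let $\Pi_\sigma$ be the orthogonal projection of spacetime $n$-tensor fields on $\mathcal M$ that projects each transversal slot of $\sigma$ onto $\mathbb R\tau$ and each instantaneous slot onto $\operatorname{span}(\partial_1X,\partial_2X)$. For a spacetime $n$-tensor field $R$ let $[\![R]\!]_\sigma$ be the surface $(n-\alpha)$-tensor field obtained from $\Pi_\sigma R$ by contracting the transversal slots with $\zeta\tau$ and dropping the (vanishing) time-like components, and put $[\![R]\!]=\sum_{\alpha=0}^n\sum_{\sigma\in \mathrm{Sh}(n,\alpha)}[\![R]\!]_\sigma e_\sigma$, where $e_\sigma$ are formal basis symbols, so that $[\![R]\!]$ is an element of the product, over all shuffles, of the bundles of surface $(n-\alpha)$-tensors. The inverse of $[\![\cdot]\!]$ sends $\sum_\sigma r_\sigma e_\sigma$ to the sum over $\sigma$ of the tensor fields with $\tau$ in the transversal slots and $r_\sigma^{i_1\dots i_{n-\alpha}}\,\partial_{i_1}X\otimes\dots\otimes\partial_{i_{n-\alpha}}X$ in the instantaneous slots. The material derivative of $r=\sum_\sigma r_\sigma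 e_\sigma$ is $D_{\mathfrak m}r=[\![\nabla_{\tau_{\mathfrak m}}[\![r]\!]^{-1}]\!]$, where $\nabla_{\tau_{\mathfrak m}}R=\{R^{I_1\dots I_n}{}_{;t}+u^kR^{I_1\dots I_n}{}_{;k}\}$. *Claim.* Let $n\ge0$ and let $r=\sum_{\alpha=0}^n\sum_{\sigma\in \mathrm{Sh}(n,\alpha)}r_\sigma e_\sigma$ with smooth surface $(n-\alpha)$-tensor fields $r_\sigma$. Then $D_{\mathfrak m}r=\sum_{\alpha=0}^n\sum_{\sigma\in \mathrm{Sh}(n,\alpha)}(D_\sigma r)e_\sigma$ with smooth surface $(n-\alpha)$-tensor fields $D_\sigma r$, i.e. $\nabla_{\tau_{\mathfrak m}}[\![r]\!]^{-1}=[\![\sum_\sigma (D_\sigma r)e_\sigma]\!]^{-1}$, and for every $\sigma\in \mathrm{Sh}(n,\alpha)$ and all indices $$\begin{aligned}{}[D_\sigma r]^{i_1\dots i_{n-\alpha}}={}&\partial_tr_\sigma^{i_1\dots i_{n-\alpha}}+[\nabla_ur_\sigma]^{i_1\dots i_{n-\alpha}}+\alpha\zeta\nu\dot\nu\,r_\sigma^{i_1\dots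 i_{n-\alpha}}+\zeta\nu\,(b_{\mathfrak m})_k\sum_{\beta=1}^{\alpha}r_{\sigma^\beta}^{i_1\dots i_{\bar\beta-1}\,k\,i_{\bar\beta}\dots i_{n-\alpha}}\\&+\sum_{\beta=1}^{n-\alpha}\Big(\mathcal B^{i_\beta}{}_k\,r_\sigma^{i_1\dots i_{\beta-1}\,k\,i_{\beta+1}\dots i_{n-\alpha}}-\nu\, b_{\mathfrak m}^{i_\beta}\,r_{\sigma_\beta}^{i_1\dots\widehat{i_\beta}\dots i_{n-\alpha}}\Big).\end{aligned}$$ -/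

import Mathlib

open scoped ContDiff

noncomputable section

namespace MovingSurface

/-! ### Shuffles -/

/-- A shuffle of the `n` tensor slots: a permutation that is written as a bijection from
`α` front (transversal) places followed by `m = n - α` rear (instantaneous) places,
and that is increasing on the front places and increasing on the rear places. -/
structure Shuffle (n : ℕ) where
  /-- number of transversal slots -/
  α : ℕ
  /-- number of instantaneous slots -/
  m : ℕ
  /-- the permutation `(σ(1) … σ(α) | σ(α+1) … σ(n))` -/
  perm : Fin α ⊕ Fin m ≃ Fin n
  front_mono : StrictMono fun k => perm (Sum.inl k)
  rear_mono : StrictMono fun l => perm (Sum.inr l)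

namespace Shuffle

variable {n : ℕ}

/-- `σ(k)` for a front place `k`. -/
def front (σ : Shuffle n) (k : Fin σ.α) : Fin n := σ.perm (Sum.inl k)

/-- `σ(α + l)` for a rear place `l`. -/
def rear (σ : Shuffle n) (l : Fin σ.m) : Fin n := σ.perm (Sum.inr l)

/-- The set of transversal slots. -/
def transSet (σ : Shuffle n) : Finset (Fin n) := Finset.univ.image σ.front

theorem front_injective (σ : Shuffle n) : Function.Injective σ.front :=
  fun _ _ h => σ.front_mono.injective h

theorem add_eq (σ : Shuffle n) : σ.α + σ.m = n := by
  simpa using Fintype.card_congr σ.perm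

theorem card_transSet (σ : Shuffle n) : σ.transSet.card = σ.α := by
  rw [transSet, Finset.card_image_of_injective _ σ.front_injective]
  simp

theorem front_mem (σ : Shuffle n) (k : Fin σ.α) : σ.front k ∈ σ.transSet :=
  Finset.mem_image_of_mem _ (Finset.mem_univ k)

theorem rear_notMem (σ : Shuffle n) (l : Fin σ.m) : σ.rear l ∉ σ.transSet := by
  intro h
  obtain ⟨k, -, hk⟩ := Finset.mem_image.1 h
  have := σ.perm.injective hk
  simp at this

/-- The shuffle whose transversal slots are the elements of `T`: the elements of `T` in
increasing order, followed by the other slots in increasing order. -/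
def ofSet (T : Finset (Fin n)) (a b : ℕ) (ha : T.card = a) (hb : Tᶜ.card = b) : Shuffle n where
  α := a
  m := b
  perm := finSumEquivOfFinset ha hb
  front_mono := by
    intro x y h
    simpa using h
  rear_mono := by
    intro x y h
    simpa using h

theorem transSet_ofSet (T : Finset (Fin n)) (a b : ℕ) (ha : T.card = a) (hb : Tᶜ.card = b) :
    (ofSet T a b ha hb).transSet = T := by
  have : (ofSet T a b ha hb).front = T.orderEmbOfFin ha := by
    funext k
    exact finSumEquivOfFinset_inl ha hb k
  rw [transSet, this]
  exact T.image_orderEmbOfFin_univ ha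

theorem ext_transSet {σ σ' : Shuffle n} (h : σ.transSet = σ'.transSet) : σ = σ' := by
  have key : ∀ τ : Shuffle n, τ = ofSet τ.transSet τ.α τ.m τ.card_transSet
      (by rw [Finset.card_compl, τ.card_transSet, Fintype.card_fin]; have := τ.add_eq; omega) := by
    intro τ
    have hc : τ.transSetᶜ.card = τ.m := by
      rw [Finset.card_compl, τ.card_transSet, Fintype.card_fin]; have := τ.add_eq; omega
    have hp : τ.perm = finSumEquivOfFinset τ.card_transSet hc := by
      apply Equiv.ext
      rintro (k | l)
      · rw [finSumEquivOfFinset_inl]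
        exact congrFun (Finset.orderEmbOfFin_unique τ.card_transSet τ.front_mem τ.front_mono) k
      · rw [finSumEquivOfFinset_inr]
        exact congrFun (Finset.orderEmbOfFin_unique hc
          (fun l => Finset.mem_compl.2 (τ.rear_notMem l)) τ.rear_mono) l
    obtain ⟨a, b, p, h1, h2⟩ := τ
    simp only [ofSet]
    congr
  have hα : σ.α = σ'.α := by rw [← σ.card_transSet, ← σ'.card_transSet, h]
  have hm : σ.m = σ'.m := by have := σ.add_eq; have := σ'.add_eq; omega
  rw [key σ, key σ']
  congr

/-- There are finitely many shuffles (namely `2 ^ n`). -/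
instance : Fintype (Shuffle n) :=
  Fintype.ofInjective (transSet (n := n)) fun _ _ h => ext_transSet h

/-- `σ^β`: the `β`-th transversal slot is converted into an instantaneous one. -/
def raise (σ : Shuffle n) (β : Fin σ.α) : Shuffle n :=
  ofSet (σ.transSet.erase (σ.front β)) (σ.α - 1) (σ.m + 1)
    (by rw [Finset.card_erase_of_mem (σ.front_mem β), σ.card_transSet])
    (by
      rw [Finset.card_compl, Finset.card_erase_of_mem (σ.front_mem β), σ.card_transSet,
        Fintype.card_fin]
      have := σ.add_eq
      have := β.isLt
      omega)

/-- `σ_β`: the `β`-th instantaneous slot is converted into a transversal one. -/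
def lower (σ : Shuffle n) (β : Fin σ.m) : Shuffle n :=
  ofSet (insert (σ.rear β) σ.transSet) (σ.α + 1) (σ.m - 1)
    (by rw [Finset.card_insert_of_notMem (σ.rear_notMem β), σ.card_transSet])
    (by
      rw [Finset.card_compl, Finset.card_insert_of_notMem (σ.rear_notMem β), σ.card_transSet,
        Fintype.card_fin]
      have := σ.add_eq
      have := β.isLt
      omega)

/-- `β̄` for `σ^β`: the place that the slot `σ(β)` occupies among the instantaneous slots of
`σ^β`; it is determined by `(σ^β)_{β̄} = σ`, see `lower_raise_bar`. -/
def bar (σ : Shuffle n) (β : Fin σ.α) : Fin (σ.m + 1) :=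
  Sum.elim (fun _ => 0) id ((σ.raise β).perm.symm (σ.front β))

theorem rear_raise_bar (σ : Shuffle n) (β : Fin σ.α) :
    (σ.raise β).rear (σ.bar β) = σ.front β := by
  rcases h : (σ.raise β).perm.symm (σ.front β) with k | l
  · exfalso
    have h1 : (σ.raise β).front k = σ.front β := by
      rw [front, ← h, Equiv.apply_symm_apply]
    have h2 := (σ.raise β).front_mem k
    rw [h1, raise, transSet_ofSet] at h2
    simp at h2
  · have h1 : σ.bar β = l := by
      rw [bar, h]
      rfl
    rw [h1, rear, ← h, Equiv.apply_symm_apply]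

theorem lower_raise_bar (σ : Shuffle n) (β : Fin σ.α) :
    (σ.raise β).lower (σ.bar β) = σ := by
  apply ext_transSet
  refine (transSet_ofSet _ _ _ _ _).trans ?_
  have h : (σ.raise β).transSet = σ.transSet.erase (σ.front β) := transSet_ofSet _ _ _ _ _
  rw [rear_raise_bar, h, Finset.insert_erase (σ.front_mem β)]

/-- The multi-index on all `n` slots with entries `J` on the transversal slots of `σ` and
entries `K` on the instantaneous slots of `σ`. -/
def join {ι : Type*} (σ : Shuffle n) (J : Fin σ.α → ι) (K : Fin σ.m → ι) : Fin n → ι :=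
  fun s => Sum.elim J K (σ.perm.symm s)

end Shuffle

/-- `i₁ … î_β … i_m`: the multi-index without its `β`-th entry. -/
def omitAt {ι : Type*} : {m : ℕ} → Fin m → (Fin m → ι) → Fin (m - 1) → ι
  | _ + 1, β, i => β.removeNth i

/-! ### Moving surfaces in an observer parametrization

Coordinates are `c = (t, y¹, y²)`. Spacetime indices `I, J, K` range over `Fin 3`, with `0` for `t`;
the spatial index `i : Fin 2` corresponds to the spacetime index `i.succ`. -/

/-- Coordinate space, with points `(t, y¹, y²)`. -/
abbrev Coord := Fin 3 → ℝ

/-- Euclidean space. -/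
abbrev E3 := EuclideanSpace ℝ (Fin 3)

/-- Euclidean spacetime, with the Euclidean inner product of `ℝ⁴`. -/
abbrev E4 := WithLp 2 (ℝ × E3)

/-- Partial derivative `∂_I f`. -/
def pd {F : Type*} [NormedAddCommGroup F] [NormedSpace ℝ F] (I : Fin 3) (f : Coord → F)
    (c : Coord) : F :=
  fderiv ℝ f c (Pi.single I 1)

/-- A patch of a moving surface in `ℝ³`, in an arbitrary observer parametrization
`Z = Z(t, y¹, y²)`, with a smooth unit normal field `N`. -/
structure ObserverPatch where
  /-- coordinate domain -/
  U : Set Coord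
  isOpen_U : IsOpen U
  /-- observer parametrization -/
  Z : Coord → E3
  smooth_Z : ContDiffOn ℝ ∞ Z U
  immersion : ∀ c ∈ U, LinearIndependent ℝ fun i : Fin 2 => pd i.succ Z c
  /-- normal field -/
  N : Coord → E3
  smooth_N : ContDiffOn ℝ ∞ N U
  norm_N : ∀ c ∈ U, ‖N c‖ = 1
  orth_N : ∀ c ∈ U, ∀ i : Fin 2, inner ℝ (pd i.succ Z c) (N c) = 0

/-- Proxy functions `r^{i₁…i_m}(t, y)` of a (time-dependent) surface `m`-tensor field. -/
abbrev SurfTensor (m : ℕ) := (Fin m → Fin 2) → Coord → ℝ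

/-- Proxy functions `R^{I₁…I_n}(t, y)` of a spacetime `n`-tensor field. -/
abbrev SpacetimeTensor (n : ℕ) := (Fin n → Fin 3) → Coord → ℝ

/-- The product of surface tensor bundles over all shuffles; an element `r` stands for
`∑_σ r_σ e_σ`, where `r_σ` is a surface `(n - α)`-tensor field. -/
abbrev BundleTensor (n : ℕ) := (σ : Shuffle n) → SurfTensor σ.m

namespace ObserverPatch

variable (P : ObserverPatch)

/-! #### Geometry of the moving surface -/

/-- Observer velocity `V = ∂_t Z`. -/
def V (c : Coord) : E3 := pd 0 P.Z c

/-- Normal velocity `ν = ⟨V, N⟩`. -/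
def ν (c : Coord) : ℝ := inner ℝ (P.V c) (P.N c)

/-- Spatial metric `g_{ij}`. -/
def g (c : Coord) : Matrix (Fin 2) (Fin 2) ℝ :=
  Matrix.of fun i j => inner ℝ (pd i.succ P.Z c) (pd j.succ P.Z c)

/-- Inverse spatial metric `g^{ij}`. -/
def gInv (c : Coord) : Matrix (Fin 2) (Fin 2) ℝ := (P.g c)⁻¹

/-- Tangential observer velocity `v^i`, so that `V = v^i ∂_i Z + ν N`. -/
def v (i : Fin 2) (c : Coord) : ℝ := ∑ j, P.gInv c i j * inner ℝ (P.V c) (pd j.succ P.Z c)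

/-- Second fundamental form `II_{ij} = ⟨∂_i ∂_j Z, N⟩`. -/
def II (i j : Fin 2) (c : Coord) : ℝ := inner ℝ (pd i.succ (pd j.succ P.Z) c) (P.N c)

/-- Christoffel symbols `Γ^k_{ij}` of the Levi-Civita connection of `g`. -/
def Γ (k i j : Fin 2) (c : Coord) : ℝ :=
  (1 / 2) * ∑ l, P.gInv c k l *
    (pd i.succ (fun x => P.g x j l) c + pd j.succ (fun x => P.g x i l) c
      - pd l.succ (fun x => P.g x i j) c)

/-- Spatial covariant derivative `r^{i₁…i_m}_{|k}`. -/
def surfCov {m : ℕ} (r : SurfTensor m) (i : Fin m → Fin 2) (k : Fin 2) (c : Coord) : ℝ :=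
  pd k.succ (r i) c + ∑ β : Fin m, ∑ j, P.Γ (i β) k j c * r (Function.update i β j) c

/-- `𝓑^i_k`, the mixed components of `𝓑 = ∇v - ν II`. -/
def B (i k : Fin 2) (c : Coord) : ℝ :=
  P.surfCov (fun q : Fin 1 → Fin 2 => P.v (q 0)) (fun _ => i) k c
    - P.ν c * ∑ l, P.gInv c i l * P.II l k c

/-! #### Geometry of the spacetime surface -/

/-- Spacetime parametrization `X = (t, Z)`. -/
def X (c : Coord) : E4 := WithLp.toLp 2 (c 0, P.Z c)

/-- Spacetime metric `η_{IJ} = ⟨∂_I X, ∂_J X⟩`. -/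
def η (c : Coord) : Matrix (Fin 3) (Fin 3) ℝ :=
  Matrix.of fun I J => inner ℝ (pd I P.X c) (pd J P.X c)

/-- Inverse spacetime metric `η^{IJ}`. -/
def ηInv (c : Coord) : Matrix (Fin 3) (Fin 3) ℝ := (P.η c)⁻¹

/-- Spacetime Christoffel symbols `γ^K_{IJ}` of the Levi-Civita connection of `η`. -/
def γ (K I J : Fin 3) (c : Coord) : ℝ :=
  (1 / 2) * ∑ L, P.ηInv c K L *
    (pd I (fun x => P.η x J L) c + pd J (fun x => P.η x I L) c - pd L (fun x => P.η x I J) c)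

/-- Spacetime covariant derivative `R^{I₁…I_n}_{;K}`. -/
def stCov {n : ℕ} (R : SpacetimeTensor n) (I : Fin n → Fin 3) (K : Fin 3) (c : Coord) : ℝ :=
  pd K (R I) c + ∑ β : Fin n, ∑ J, P.γ (I β) K J c * R (Function.update I β J) c

/-- Transversal direction `τ = [1, -v]`, contravariant components `τ^I`. -/
def τ (I : Fin 3) (c : Coord) : ℝ := Fin.cases 1 (fun i => -P.v i c) I

/-- Covariant components `τ_I`. -/
def τFlat (I : Fin 3) (c : Coord) : ℝ := ∑ J, P.η c I J * P.τ J c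

/-- `ζ = 1 / (1 + ν²)`. -/
def ζ (c : Coord) : ℝ := 1 / (1 + P.ν c ^ 2)

/-- Orthogonal transversal projection `ζ τ^I τ_J`. -/
def projTrans (I J : Fin 3) (c : Coord) : ℝ := P.ζ c * P.τ I c * P.τFlat J c

/-- Orthogonal instantaneous projection `δ^I_J - ζ τ^I τ_J`. -/
def projInst (I J : Fin 3) (c : Coord) : ℝ := (if I = J then 1 else 0) - P.projTrans I J c

/-! #### The decomposition of spacetime tensors -/

variable {n : ℕ}

/-- Orthogonal shuffled projection `Π_σ`. -/
def shuffleProj (σ : Shuffle n) (R : SpacetimeTensor n) : SpacetimeTensor n := fun I c =>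
  ∑ J : Fin n → Fin 3,
    (∏ k, P.projTrans (I (σ.front k)) (J (σ.front k)) c) *
      (∏ l, P.projInst (I (σ.rear l)) (J (σ.rear l)) c) * R J c

/-- `φ_σ`: the transversal slots are tested with `ζ τ`. -/
def φ (σ : Shuffle n) (R : SpacetimeTensor n) : SpacetimeTensor σ.m := fun K c =>
  ∑ J : Fin σ.α → Fin 3, P.ζ c ^ σ.α * (∏ k, P.τFlat (J k) c) * R (σ.join J K) c

/-- `φ_σ⁻¹`: the transversal slots are filled with `τ`. -/
def φInv (σ : Shuffle n) (R : SpacetimeTensor σ.m) : SpacetimeTensor n := fun I c =>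
  (∏ k, P.τ (I (σ.front k)) c) * R (fun l => I (σ.rear l)) c

/-- `ι`: the time-like components (which vanish for instantaneous tensors) are cut off. -/
def cut {m : ℕ} (R : SpacetimeTensor m) : SurfTensor m := fun i => R fun l => (i l).succ

/-- `ι⁻¹`: extension by zero in all time-like components. -/
def cutInv {m : ℕ} (r : SurfTensor m) : SpacetimeTensor m := fun I c =>
  if h : ∀ l, I l ≠ 0 then r (fun l => (I l).pred (h l)) c else 0

/-- The isomorphism `⟦R⟧ = ∑_σ ⟦Π_σ R⟧_σ e_σ` with `⟦·⟧_σ` given by `φ_σ` followed by `ι`. -/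
def bracket (R : SpacetimeTensor n) : BundleTensor n := fun σ =>
  cut (P.φ σ (P.shuffleProj σ R))

/-- Its inverse `⟦∑_σ r_σ e_σ⟧⁻¹ = ∑_σ ⟦r_σ⟧_σ⁻¹`. -/
def bracketInv (r : BundleTensor n) : SpacetimeTensor n := fun I c =>
  ∑ σ : Shuffle n, P.φInv σ (cutInv (r σ)) I c

/-! #### Material derivatives

The material is given by the components `vm i` of its tangential velocity `v_𝔪`; the material
velocity is `V_𝔪 = v_𝔪 + ν N`. -/

variable (vm : Fin 2 → Coord → ℝ)

/-- Relative velocity `u = v_𝔪 - v`. -/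
def u (i : Fin 2) (c : Coord) : ℝ := vm i c - P.v i c

/-- Material direction `τ_𝔪 = [1, u]`. -/
def τm (I : Fin 3) (c : Coord) : ℝ := Fin.cases 1 (fun i => P.u vm i c) I

/-- Material derivative `∇_{τ_𝔪} R` of a spacetime tensor field. -/
def stMaterial (R : SpacetimeTensor n) : SpacetimeTensor n := fun I c =>
  ∑ K, P.τm vm K c * P.stCov R I K c

/-- Material derivative `⟦·⟧ ∘ ∇_{τ_𝔪} ∘ ⟦·⟧⁻¹` on the spacetime tensor bundle of the moving
surface. -/
def material (r : BundleTensor n) : BundleTensor n :=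
  P.bracket (P.stMaterial vm (P.bracketInv r))

/-- Material derivative `ḟ = ∂_t f + ∇_u f` of a scalar field. -/
def dot (f : Coord → ℝ) (c : Coord) : ℝ := pd 0 f c + ∑ k, P.u vm k c * pd k.succ f c

/-- Surface directional covariant derivative `[∇_u r]^{i₁…i_m} = u^k r^{i₁…i_m}_{|k}`. -/
def surfCovAlong {m : ℕ} (r : SurfTensor m) (i : Fin m → Fin 2) (c : Coord) : ℝ :=
  ∑ k, P.u vm k c * P.surfCov r i k c

/-- Covariant components of `b_𝔪 = ∇ν + II v_𝔪`. -/
def bm (k : Fin 2) (c : Coord) : ℝ := pd k.succ P.ν c + ∑ j, P.II k j c * vm j c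

/-- Contravariant components of `b_𝔪`. -/
def bmSharp (i : Fin 2) (c : Coord) : ℝ := ∑ k, P.gInv c i k * P.bm vm k c

end ObserverPatch

end MovingSurface

end

noncomputable section

namespace MovingSurface

/-! In the frame τ, ∂_1 X, ∂_2 X the decomposition is mere relabelling. A multi-index with entries
in {0, 1, 2} amounts to a shuffle σ, whose transversal slots are the zeros, and a spatial
multi-index i on the other slots; this is `multi`. In this frame ⟦r⟧⁻¹ has the component r_σ^i at
`σ.multi i` (`bracketInv_eq_expand`, `frameComp_multi`), and ⟦·⟧ reads that component off
(`bracket_eq_comp`).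

By the Leibniz rule, ∇_{τ_𝔪} acts on frame components as ∂_t + u^k ∂_k plus, for each slot, a
contraction with the 3×3 matrix `connForm` that expresses the derivatives of the frame fields in the
frame (`comp_stMaterial_expand`). Changing one entry of `σ.multi i` keeps σ, or leads to σ^β (a zero
becomes spatial) or to σ_β (a spatial entry becomes zero). The four blocks of the matrix are thus
the four kinds of terms: ζνν̇, ζν b_𝔪, -ν b_𝔪^♯ and uΓ + 𝓑.

The matrix is found extrinsically. The second derivatives of X are (0, ∂_I ∂_J Z), and since τ = (1,
νN), the vector (0, N) projects to ζντ on the spacetime surface. Hence the spacetime Christoffel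
symbols are given by the normal and tangential parts of ∂_I ∂_J Z (`γ_eq`). Those with a time index
follow from differentiating ∂_t Z = v^i ∂_i Z + νN (`hessNormal_zero`, `hessTangent_zero`);
contraction with τ_𝔪 gives the matrix (`cov_frame_along`). -/

theorem apply_omitAt {ι κ : Type*} (f : ι → κ) {m : ℕ} (β : Fin m) (i : Fin m → ι)
    (l : Fin (m - 1)) : f (omitAt β i l) = omitAt β (fun l => f (i l)) l := by
  cases m with
  | zero => exact β.elim0
  | succ m => rfl

theorem strictMono_omitAt {n m : ℕ} (β : Fin m) {f : Fin m → Fin n} (hf : StrictMono f) :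
    StrictMono (omitAt β f) := by
  cases m with
  | zero => exact β.elim0
  | succ m => exact hf.comp (Fin.strictMono_succAbove β)

theorem omitAt_ne {n m : ℕ} (β : Fin m) {f : Fin m → Fin n} (hf : StrictMono f)
    (l : Fin (m - 1)) : omitAt β f l ≠ f β := by
  cases m with
  | zero => exact β.elim0
  | succ m => exact fun h => Fin.succAbove_ne β l (hf.injective h)

theorem exists_omitAt {ι : Type*} {m : ℕ} (β : Fin m) (f : Fin m → ι)
    (l : Fin (m - 1)) : ∃ k, omitAt β f l = f k := by
  cases m with
  | zero => exact β.elim0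
  | succ m => exact ⟨β.succAbove l, rfl⟩

/-! ### Combinatorics of shuffles and multi-indices -/

namespace Shuffle

variable {n : ℕ}

theorem forall_slot (σ : Shuffle n) {p : Fin n → Prop} (hf : ∀ k, p (σ.front k))
    (hr : ∀ l, p (σ.rear l)) (s : Fin n) : p s := by
  obtain ⟨k | l, rfl⟩ := σ.perm.surjective s
  · exact hf k
  · exact hr l

theorem rear_injective (σ : Shuffle n) : Function.Injective σ.rear :=
  fun _ _ h => σ.rear_mono.injective h

theorem front_ne_rear (σ : Shuffle n) (k : Fin σ.α) (l : Fin σ.m) : σ.front k ≠ σ.rear l :=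
  fun h => σ.rear_notMem l (h ▸ σ.front_mem k)

theorem sum_slot {M : Type*} [AddCommMonoid M] (σ : Shuffle n) (f : Fin n → M) :
    ∑ s, f s = ∑ k, f (σ.front k) + ∑ l, f (σ.rear l) := by
  rw [← Equiv.sum_comp σ.perm, Fintype.sum_sum_type]
  rfl

theorem prod_slot {M : Type*} [CommMonoid M] (σ : Shuffle n) (f : Fin n → M) :
    ∏ s, f s = (∏ k, f (σ.front k)) * ∏ l, f (σ.rear l) := by
  rw [← Equiv.prod_comp σ.perm, Fintype.prod_sum_type]
  rfl

@[simp] theorem join_front {ι : Type*} (σ : Shuffle n) (J : Fin σ.α → ι) (K : Fin σ.m → ι)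
    (k : Fin σ.α) : σ.join J K (σ.front k) = J k := by
  simp [join, front]

@[simp] theorem join_rear {ι : Type*} (σ : Shuffle n) (J : Fin σ.α → ι) (K : Fin σ.m → ι)
    (l : Fin σ.m) : σ.join J K (σ.rear l) = K l := by
  simp [join, rear]

theorem eq_join {ι : Type*} (σ : Shuffle n) {a : Fin n → ι} {J : Fin σ.α → ι}
    {K : Fin σ.m → ι} (hJ : ∀ k, a (σ.front k) = J k) (hK : ∀ l, a (σ.rear l) = K l) :
    a = σ.join J K :=
  funext <| σ.forall_slot (by simpa using hJ) (by simpa using hK)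

/-- The multi-index with entry `0` on the transversal slots and the spatial entries `i` on the
instantaneous slots. -/
def multi (σ : Shuffle n) (i : Fin σ.m → Fin 2) : Fin n → Fin 3 :=
  σ.join (fun _ => 0) fun l => (i l).succ

@[simp] theorem multi_front (σ : Shuffle n) (i : Fin σ.m → Fin 2) (k : Fin σ.α) :
    σ.multi i (σ.front k) = 0 := by
  simp [multi]

@[simp] theorem multi_rear (σ : Shuffle n) (i : Fin σ.m → Fin 2) (l : Fin σ.m) :
    σ.multi i (σ.rear l) = (i l).succ := by
  simp [multi]

theorem mem_transSet_iff_multi (σ : Shuffle n) (i : Fin σ.m → Fin 2) (s : Fin n) :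
    s ∈ σ.transSet ↔ σ.multi i s = 0 := by
  refine σ.forall_slot (p := fun s => s ∈ σ.transSet ↔ σ.multi i s = 0) (fun k => ?_)
    (fun l => ?_) s
  · simp [σ.front_mem]
  · simp [σ.rear_notMem, Fin.succ_ne_zero]

/-- The zeros of the multi-index serve as the transversal set. Statements about all frame components
may therefore be checked on multi-indices of the form `σ.multi i`. -/
theorem exists_eq_multi (a : Fin n → Fin 3) : ∃ (σ : Shuffle n) (i : Fin σ.m → Fin 2),
    a = σ.multi i := by
  classical
  let T : Finset (Fin n) := Finset.univ.filter fun s => a s = 0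
  let σ := ofSet T T.card Tᶜ.card rfl rfl
  have hT : σ.transSet = T := transSet_ofSet _ _ _ _ _
  have hr : ∀ l, a (σ.rear l) ≠ 0 := fun l h => σ.rear_notMem l (by simp [hT, T, h])
  refine ⟨σ, fun l => (a (σ.rear l)).pred (hr l), σ.eq_join (fun k => ?_) (fun l => ?_)⟩
  · have := σ.front_mem k
    simpa [hT, T] using this
  · simp

theorem transSet_raise (σ : Shuffle n) (β : Fin σ.α) :
    (σ.raise β).transSet = σ.transSet.erase (σ.front β) := transSet_ofSet _ _ _ _ _

theorem transSet_lower (σ : Shuffle n) (β : Fin σ.m) :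
    (σ.lower β).transSet = insert (σ.rear β) σ.transSet := transSet_ofSet _ _ _ _ _

theorem card_compl_transSet (σ : Shuffle n) : σ.transSetᶜ.card = σ.m := by
  rw [Finset.card_compl, σ.card_transSet, Fintype.card_fin]
  have := σ.add_eq
  omega

/-- A finite set has only one increasing enumeration; here the set is the complement of `transSet`.
Both descriptions of rear slots below rest on this. -/
theorem rear_unique (σ : Shuffle n) {f : Fin σ.m → Fin n} (hf : StrictMono f)
    (h : ∀ l, f l ∉ σ.transSet) : f = σ.rear :=
  (Finset.orderEmbOfFin_unique σ.card_compl_transSet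
    (fun l => Finset.mem_compl.2 (h l)) hf).trans
  (Finset.orderEmbOfFin_unique σ.card_compl_transSet
    (fun l => Finset.mem_compl.2 (σ.rear_notMem l)) σ.rear_mono).symm

theorem rear_lower (σ : Shuffle n) (β : Fin σ.m) :
    (σ.lower β).rear = omitAt β σ.rear := by
  refine ((σ.lower β).rear_unique (strictMono_omitAt β σ.rear_mono) fun l => ?_).symm
  have h1 : omitAt β σ.rear l ≠ σ.rear β := omitAt_ne β σ.rear_mono l
  obtain ⟨k, hk⟩ := exists_omitAt β σ.rear l
  intro h
  rw [transSet_lower, Finset.mem_insert] at h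
  rcases h with h | h
  · exact h1 h
  · exact σ.rear_notMem k (hk ▸ h)

theorem rear_raise_succAbove (σ : Shuffle n) (β : Fin σ.α) (l : Fin σ.m) :
    (σ.raise β).rear ((σ.bar β).succAbove l) = σ.rear l := by
  refine congrFun (σ.rear_unique (f := fun l => (σ.raise β).rear ((σ.bar β).succAbove l))
    (fun _ _ h => (σ.raise β).rear_mono (Fin.strictMono_succAbove (σ.bar β) h))
    fun l h => ?_) l
  refine (σ.raise β).rear_notMem ((σ.bar β).succAbove l) ?_
  rw [transSet_raise, Finset.mem_erase]
  refine ⟨fun h' => ?_, h⟩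
  rw [← rear_raise_bar] at h'
  exact Fin.succAbove_ne _ _ ((σ.raise β).rear_injective h')

theorem update_multi_front_zero (σ : Shuffle n) (i : Fin σ.m → Fin 2) (β : Fin σ.α) :
    Function.update (σ.multi i) (σ.front β) 0 = σ.multi i := by
  rw [Function.update_eq_self_iff, multi_front]

theorem update_multi_rear_succ (σ : Shuffle n) (i : Fin σ.m → Fin 2) (β : Fin σ.m) (k : Fin 2) :
    Function.update (σ.multi i) (σ.rear β) k.succ = σ.multi (Function.update i β k) := by
  refine σ.eq_join (fun q => ?_) fun l => ?_
  · rw [Function.update_of_ne (σ.front_ne_rear _ _), multi_front]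
  · by_cases h : l = β
    · subst h; simp
    · rw [Function.update_of_ne (σ.rear_injective.ne h), Function.update_of_ne h, multi_rear]

/-- The new zero enlarges the transversal set by one slot, and the remaining spatial entries keep
their order. This produces the r_{σ_β} terms. -/
theorem update_multi_rear_zero (σ : Shuffle n) (i : Fin σ.m → Fin 2) (β : Fin σ.m) :
    Function.update (σ.multi i) (σ.rear β) 0 = (σ.lower β).multi (omitAt β i) := by
  refine (σ.lower β).eq_join (fun q => ?_) fun l => ?_
  · have h := (σ.lower β).front_mem q
    rw [transSet_lower, Finset.mem_insert] at h
    rcases h with h | h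
    · rw [h]; simp
    · rw [σ.mem_transSet_iff_multi i] at h
      by_cases h' : (σ.lower β).front q = σ.rear β
      · rw [h']; simp
      · rw [Function.update_of_ne h', h]
  · have key : ∀ l : Fin (σ.m - 1), Function.update (σ.multi i) (σ.rear β) 0
        (omitAt β σ.rear l) = (omitAt β i l).succ := fun l => by
      have h : omitAt β σ.rear l ≠ σ.rear β := omitAt_ne β σ.rear_mono l
      rw [Function.update_of_ne h, apply_omitAt (σ.multi i),
        apply_omitAt Fin.succ]
      simp only [multi_rear]
    rw [rear_lower]
    exact key l

/-- The overwritten zero leaves the transversal set, and its slot sits at place β̄ among the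
instantaneous ones. This produces the r_{σ^β} terms. -/
theorem update_multi_front_succ (σ : Shuffle n) (i : Fin σ.m → Fin 2) (β : Fin σ.α)
    (k : Fin 2) : Function.update (σ.multi i) (σ.front β) k.succ =
      (σ.raise β).multi ((σ.bar β).insertNth k i) := by
  refine (σ.raise β).eq_join (fun q => ?_) fun l => ?_
  · have h := (σ.raise β).front_mem q
    rw [transSet_raise, Finset.mem_erase] at h
    rw [Function.update_of_ne h.1]
    exact (σ.mem_transSet_iff_multi i _).1 h.2
  · revert l
    refine (Fin.forall_iff_succAbove (σ.bar β)).2 ⟨?_, fun l => ?_⟩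
    · rw [rear_raise_bar, Function.update_self]
      exact congrArg Fin.succ (Fin.insertNth_apply_same (α := fun _ => Fin 2) _ k i).symm
    · rw [rear_raise_succAbove, Function.update_of_ne (σ.front_ne_rear _ _).symm, multi_rear]
      exact congrArg Fin.succ (Fin.insertNth_apply_succAbove (α := fun _ => Fin 2) _ k i l).symm

end Shuffle

/-! ### Calculus of coordinate derivatives -/

section Calculus

variable {F : Type*} [NormedAddCommGroup F] [NormedSpace ℝ F] {U : Set Coord} {c : Coord}

theorem differentiableAt_of_contDiffOn (hU : IsOpen U) {f : Coord → F}
    (hf : ContDiffOn ℝ ∞ f U) (hc : c ∈ U) : DifferentiableAt ℝ f c :=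
  (hf.contDiffAt (hU.mem_nhds hc)).differentiableAt (by simp)

theorem contDiffOn_pd (hU : IsOpen U) {f : Coord → F} (hf : ContDiffOn ℝ ∞ f U) (I : Fin 3) :
    ContDiffOn ℝ ∞ (pd I f) U :=
  ((contDiffOn_infty_iff_fderiv_of_isOpen hU).1 hf).2.clm_apply contDiffOn_const

theorem pd_comm (hU : IsOpen U) {f : Coord → F} (hf : ContDiffOn ℝ ∞ f U) (hc : c ∈ U)
    (I J : Fin 3) : pd I (pd J f) c = pd J (pd I f) c := by
  have hd : DifferentiableAt ℝ (fderiv ℝ f) c :=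
    differentiableAt_of_contDiffOn hU ((contDiffOn_infty_iff_fderiv_of_isOpen hU).1 hf).2 hc
  have key : ∀ I J, pd I (pd J f) c
      = fderiv ℝ (fderiv ℝ f) c (Pi.single I 1) (Pi.single J 1) := fun I J => by
    unfold pd
    rw [fderiv_clm_apply hd (differentiableAt_const _)]
    simp
  rw [key, key]
  exact (hf.contDiffAt (hU.mem_nhds hc)).isSymmSndFDerivAt
    (by rw [minSmoothness_of_isRCLikeNormedField]; exact ENat.LEInfty.out) _ _

/-- The identities of the patch hold only on its domain; openness is what allows them to be
differentiated. -/
theorem pd_congr (hU : IsOpen U) {f f' : Coord → F} (h : ∀ x ∈ U, f x = f' x) (hc : c ∈ U)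
    (I : Fin 3) : pd I f c = pd I f' c := by
  unfold pd
  rw [Filter.EventuallyEq.fderiv_eq (Filter.eventuallyEq_of_mem (hU.mem_nhds hc) h)]

theorem pd_const (I : Fin 3) (a : F) : pd I (fun _ => a) c = 0 := by
  simp [pd]

theorem pd_add {f f' : Coord → F} (hf : DifferentiableAt ℝ f c) (hf' : DifferentiableAt ℝ f' c)
    (I : Fin 3) : pd I (fun x => f x + f' x) c = pd I f c + pd I f' c := by
  unfold pd
  rw [fderiv_fun_add hf hf']
  rfl

theorem pd_sum {ι : Type*} (s : Finset ι) {f : ι → Coord → F}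
    (hf : ∀ a ∈ s, DifferentiableAt ℝ (f a) c) (I : Fin 3) :
    pd I (fun x => ∑ a ∈ s, f a x) c = ∑ a ∈ s, pd I (f a) c := by
  unfold pd
  rw [fderiv_fun_sum hf]
  simp

theorem pd_smul {a : Coord → ℝ} {f : Coord → F} (ha : DifferentiableAt ℝ a c)
    (hf : DifferentiableAt ℝ f c) (I : Fin 3) :
    pd I (fun x => a x • f x) c = pd I a c • f c + a c • pd I f c := by
  unfold pd
  rw [fderiv_fun_smul ha hf]
  simp [add_comm]

theorem pd_prod {ι : Type*} [Fintype ι] [DecidableEq ι] {f : ι → Coord → ℝ}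
    (hf : ∀ a, DifferentiableAt ℝ (f a) c) (I : Fin 3) :
    pd I (fun x => ∏ a, f a x) c = ∑ b, ∏ a, if a = b then pd I (f b) c else f a c := by
  unfold pd
  rw [fderiv_finsetProd fun a _ => hf a]
  simp only [sum_apply, smul_apply, smul_eq_mul]
  refine Finset.sum_congr rfl fun b _ => ?_
  rw [← Finset.prod_erase_mul _ _ (Finset.mem_univ b), if_pos rfl]
  congr 1
  exact Finset.prod_congr rfl fun a ha => (if_neg (Finset.ne_of_mem_erase ha)).symm

theorem pd_inner {E : Type*} [NormedAddCommGroup E] [InnerProductSpace ℝ E] {f f' : Coord → E}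
    (hf : DifferentiableAt ℝ f c) (hf' : DifferentiableAt ℝ f' c) (I : Fin 3) :
    pd I (fun x => inner ℝ (f x) (f' x)) c
      = inner ℝ (pd I f c) (f' c) + inner ℝ (pd I f' c) (f c) := by
  unfold pd
  rw [fderiv_inner_apply ℝ hf hf', add_comm, real_inner_comm (f c)]

/-- The Christoffel symbols of the first kind of an induced metric. -/
theorem christoffel_first_kind {E : Type*} [NormedAddCommGroup E] [InnerProductSpace ℝ E]
    (hU : IsOpen U) {f : Coord → E} (hf : ContDiffOn ℝ ∞ f U) (hc : c ∈ U) (I J L : Fin 3) :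
    pd I (fun x => (inner ℝ (pd J f x) (pd L f x) : ℝ)) c
      + pd J (fun x => (inner ℝ (pd I f x) (pd L f x) : ℝ)) c
      - pd L (fun x => (inner ℝ (pd I f x) (pd J f x) : ℝ)) c
      = 2 * inner ℝ (pd I (pd J f) c) (pd L f c) := by
  have hd : ∀ K, DifferentiableAt ℝ (pd K f) c := fun K =>
    differentiableAt_of_contDiffOn hU (contDiffOn_pd hU hf K) hc
  rw [pd_inner (hd _) (hd _), pd_inner (hd _) (hd _), pd_inner (hd _) (hd _),
    pd_comm hU hf hc J I, pd_comm hU hf hc L I, pd_comm hU hf hc L J]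
  ring

end Calculus

/-! ### Spatial metric and smoothness of the surface quantities -/

namespace ObserverPatch

variable (P : ObserverPatch) {c : Coord}

theorem contDiffOn_pd_Z (I : Fin 3) : ContDiffOn ℝ ∞ (pd I P.Z) P.U :=
  contDiffOn_pd P.isOpen_U P.smooth_Z I

theorem g_symm (c : Coord) (i j : Fin 2) : P.g c i j = P.g c j i :=
  real_inner_comm (pd j.succ P.Z c) (pd i.succ P.Z c)

theorem det_g_ne_zero (hc : c ∈ P.U) : (P.g c).det ≠ 0 :=
  Matrix.det_gram_ne_zero_iff_linearIndependent.2 (P.immersion c hc)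

theorem sum_gInv_mul_sum_g (hc : c ∈ P.U) (x : Fin 2 → ℝ) (i : Fin 2) :
    ∑ l, P.gInv c i l * ∑ j, P.g c l j * x j = x i := by
  have h : P.gInv c * P.g c = 1 :=
    Matrix.nonsing_inv_mul _ (isUnit_iff_ne_zero.2 (P.det_g_ne_zero hc))
  have h2 := congrFun (congrArg (fun A => A.mulVec x) h) i
  rwa [← Matrix.mulVec_mulVec, Matrix.one_mulVec] at h2

theorem sum_g_mul_sum_gInv (hc : c ∈ P.U) (x : Fin 2 → ℝ) (i : Fin 2) :
    ∑ l, P.g c i l * ∑ j, P.gInv c l j * x j = x i := by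
  have h : P.g c * P.gInv c = 1 :=
    Matrix.mul_nonsing_inv _ (isUnit_iff_ne_zero.2 (P.det_g_ne_zero hc))
  have h2 := congrFun (congrArg (fun A => A.mulVec x) h) i
  rwa [← Matrix.mulVec_mulVec, Matrix.one_mulVec] at h2

theorem contDiffOn_g (i j : Fin 2) : ContDiffOn ℝ ∞ (fun x => P.g x i j) P.U :=
  (P.contDiffOn_pd_Z _).inner ℝ (P.contDiffOn_pd_Z _)

/-- Cramer's rule: the adjugate is polynomial in the metric, and the determinant does not vanish on
the patch. -/
theorem contDiffOn_gInv (i j : Fin 2) : ContDiffOn ℝ ∞ (fun x => P.gInv x i j) P.U := by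
  have hdet : ContDiffOn ℝ ∞ (fun x => ((P.g x).det)⁻¹) P.U := by
    refine ContDiffOn.inv ?_ fun x hx => P.det_g_ne_zero hx
    simp only [Matrix.det_fin_two]
    exact ((P.contDiffOn_g 0 0).mul (P.contDiffOn_g 1 1)).sub
      ((P.contDiffOn_g 0 1).mul (P.contDiffOn_g 1 0))
  have hadj : ContDiffOn ℝ ∞ (fun x => (P.g x).adjugate i j) P.U := by
    simp only [Matrix.adjugate_fin_two]
    fin_cases i <;> fin_cases j
    · exact P.contDiffOn_g 1 1
    · exact (P.contDiffOn_g 0 1).neg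
    · exact (P.contDiffOn_g 1 0).neg
    · exact P.contDiffOn_g 0 0
  refine (hdet.mul hadj).congr fun x _ => ?_
  simp [gInv, Matrix.inv_def, Ring.inverse_eq_inv']

theorem contDiffOn_V : ContDiffOn ℝ ∞ P.V P.U := P.contDiffOn_pd_Z 0

theorem contDiffOn_ν : ContDiffOn ℝ ∞ P.ν P.U := P.contDiffOn_V.inner ℝ P.smooth_N

theorem contDiffOn_v (i : Fin 2) : ContDiffOn ℝ ∞ (P.v i) P.U :=
  ContDiffOn.sum fun j _ =>
    (P.contDiffOn_gInv i j).mul (P.contDiffOn_V.inner ℝ (P.contDiffOn_pd_Z _))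

theorem contDiffOn_ζ : ContDiffOn ℝ ∞ P.ζ P.U :=
  contDiffOn_const.div (contDiffOn_const.add (P.contDiffOn_ν.pow 2)) fun x _ => by positivity

theorem contDiffOn_II (i j : Fin 2) : ContDiffOn ℝ ∞ (P.II i j) P.U :=
  (contDiffOn_pd P.isOpen_U (P.contDiffOn_pd_Z _) _).inner ℝ P.smooth_N

theorem contDiffOn_Γ (k i j : Fin 2) : ContDiffOn ℝ ∞ (P.Γ k i j) P.U :=
  contDiffOn_const.mul <| ContDiffOn.sum fun l _ => (P.contDiffOn_gInv k l).mul <|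
    ((contDiffOn_pd P.isOpen_U (P.contDiffOn_g j l) _).add
      (contDiffOn_pd P.isOpen_U (P.contDiffOn_g i l) _)).sub
      (contDiffOn_pd P.isOpen_U (P.contDiffOn_g i j) _)

theorem contDiffOn_surfCov {m : ℕ} {r : SurfTensor m} (hr : ∀ i, ContDiffOn ℝ ∞ (r i) P.U)
    (i : Fin m → Fin 2) (k : Fin 2) : ContDiffOn ℝ ∞ (P.surfCov r i k) P.U :=
  (contDiffOn_pd P.isOpen_U (hr i) _).add <| ContDiffOn.sum fun _ _ => ContDiffOn.sum fun _ _ =>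
    (P.contDiffOn_Γ _ _ _).mul (hr _)

theorem contDiffOn_B (i k : Fin 2) : ContDiffOn ℝ ∞ (P.B i k) P.U :=
  (P.contDiffOn_surfCov (r := fun q : Fin 1 → Fin 2 => P.v (q 0))
    (fun _ => P.contDiffOn_v _) _ _).sub <|
    P.contDiffOn_ν.mul <| ContDiffOn.sum fun _ _ =>
      (P.contDiffOn_gInv _ _).mul (P.contDiffOn_II _ _)

section Material

variable {vm : Fin 2 → Coord → ℝ} (hvm : ∀ i, ContDiffOn ℝ ∞ (vm i) P.U)
include hvm

theorem contDiffOn_u (i : Fin 2) : ContDiffOn ℝ ∞ (P.u vm i) P.U :=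
  (hvm i).sub (P.contDiffOn_v i)

theorem contDiffOn_dot {f : Coord → ℝ} (hf : ContDiffOn ℝ ∞ f P.U) :
    ContDiffOn ℝ ∞ (P.dot vm f) P.U :=
  (contDiffOn_pd P.isOpen_U hf _).add <| ContDiffOn.sum fun k _ =>
    (P.contDiffOn_u hvm k).mul (contDiffOn_pd P.isOpen_U hf _)

theorem contDiffOn_surfCovAlong {m : ℕ} {r : SurfTensor m}
    (hr : ∀ i, ContDiffOn ℝ ∞ (r i) P.U) (i : Fin m → Fin 2) :
    ContDiffOn ℝ ∞ (P.surfCovAlong vm r i) P.U :=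
  ContDiffOn.sum fun k _ => (P.contDiffOn_u hvm k).mul (P.contDiffOn_surfCov hr i k)

theorem contDiffOn_bm (k : Fin 2) : ContDiffOn ℝ ∞ (P.bm vm k) P.U :=
  (contDiffOn_pd P.isOpen_U P.contDiffOn_ν _).add <| ContDiffOn.sum fun j _ =>
    (P.contDiffOn_II k j).mul (hvm j)

theorem contDiffOn_bmSharp (i : Fin 2) : ContDiffOn ℝ ∞ (P.bmSharp vm i) P.U :=
  ContDiffOn.sum fun k _ => (P.contDiffOn_gInv i k).mul (P.contDiffOn_bm hvm k)

end Material

/-! #### Splitting of the observer velocity and its derivatives -/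

/-- Three independent vectors span a three-dimensional space. The normal is independent of the
tangent vectors because it is orthogonal to their span and nonzero. -/
theorem span_tangent_normal (hc : c ∈ P.U) :
    Submodule.span ℝ (Set.range (Fin.cons (P.N c) fun i : Fin 2 => pd i.succ P.Z c :
      Fin 3 → E3)) = ⊤ := by
  refine LinearIndependent.span_eq_top_of_card_eq_finrank' ?_ (by simp)
  rw [linearIndependent_finCons]
  refine ⟨P.immersion c hc, fun h => ?_⟩
  have h0 : ∀ x ∈ Submodule.span ℝ (Set.range fun i : Fin 2 => pd i.succ P.Z c),
      (inner ℝ x (P.N c) : ℝ) = 0 := by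
    intro x hx
    induction hx using Submodule.span_induction with
    | mem x hx => obtain ⟨i, rfl⟩ := hx; exact P.orth_N c hc i
    | zero => simp
    | add x y _ _ hx hy => rw [inner_add_left, hx, hy, add_zero]
    | smul a x _ hx => rw [inner_smul_left, hx, mul_zero]
  have h1 := h0 _ h
  rw [real_inner_self_eq_norm_sq, P.norm_N c hc] at h1
  norm_num at h1

theorem inner_N_N (hc : c ∈ P.U) : (inner ℝ (P.N c) (P.N c) : ℝ) = 1 := by
  rw [real_inner_self_eq_norm_sq, P.norm_N c hc, one_pow]

theorem orth_N' (hc : c ∈ P.U) (i : Fin 2) : (inner ℝ (P.N c) (pd i.succ P.Z c) : ℝ) = 0 := by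
  rw [real_inner_comm, P.orth_N c hc]

theorem inner_pd_pd (c : Coord) (i j : Fin 2) :
    (inner ℝ (pd i.succ P.Z c) (pd j.succ P.Z c) : ℝ) = P.g c i j := rfl

theorem inner_V_pd (hc : c ∈ P.U) (l : Fin 2) :
    (inner ℝ (P.V c) (pd l.succ P.Z c) : ℝ) = ∑ j, P.g c l j * P.v j c :=
  (P.sum_g_mul_sum_gInv hc (fun l => inner ℝ (P.V c) (pd l.succ P.Z c)) l).symm

/-- The difference of the two sides is orthogonal to the normal and to both tangent vectors; these
span, so it is orthogonal to itself. -/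
theorem velocity_eq (hc : c ∈ P.U) :
    P.V c = ∑ j, P.v j c • pd j.succ P.Z c + P.ν c • P.N c := by
  rw [← sub_eq_zero]
  set D := P.V c - (∑ j, P.v j c • pd j.succ P.Z c + P.ν c • P.N c) with hD
  have hb : ∀ a, (inner ℝ ((Fin.cons (P.N c) fun i : Fin 2 => pd i.succ P.Z c :
      Fin 3 → E3) a) D : ℝ) = 0 := by
    intro a
    rw [real_inner_comm]
    refine Fin.cases ?_ (fun l => ?_) a
    · rw [Fin.cons_zero, hD, inner_sub_left, inner_add_left, sum_inner, inner_smul_left,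
        P.inner_N_N hc]
      simp [inner_smul_left, P.orth_N c hc, ν]
    · rw [Fin.cons_succ, hD, inner_sub_left, inner_add_left, sum_inner, inner_smul_left,
        P.orth_N' hc, P.inner_V_pd hc]
      simp [inner_smul_left, inner_pd_pd, P.g_symm c l, mul_comm]
  have h : ∀ x : E3, (inner ℝ x D : ℝ) = 0 := by
    intro x
    have hx : x ∈ Submodule.span ℝ (Set.range (Fin.cons (P.N c) fun i : Fin 2 =>
        pd i.succ P.Z c : Fin 3 → E3)) := by
      rw [P.span_tangent_normal hc]; trivial
    induction hx using Submodule.span_induction with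
    | mem x hx => obtain ⟨a, rfl⟩ := hx; exact hb a
    | zero => simp
    | add x y _ _ hx hy => rw [inner_add_left, hx, hy, add_zero]
    | smul a x _ hx => rw [inner_smul_left, hx, mul_zero]
  exact inner_self_eq_zero.1 (h D)

/-- Normal components of the second derivatives of the parametrization. -/
def hessNormal (I J : Fin 3) (c : Coord) : ℝ := inner ℝ (pd I (pd J P.Z) c) (P.N c)

/-- Tangential components of the second derivatives of the parametrization. -/
def hessTangent (i : Fin 2) (I J : Fin 3) (c : Coord) : ℝ :=
  ∑ l, P.gInv c i l * inner ℝ (pd I (pd J P.Z) c) (pd l.succ P.Z c)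

theorem hessNormal_symm (hc : c ∈ P.U) (I J : Fin 3) :
    P.hessNormal I J c = P.hessNormal J I c := by
  rw [hessNormal, pd_comm P.isOpen_U P.smooth_Z hc, hessNormal]

theorem hessTangent_symm (hc : c ∈ P.U) (i : Fin 2) (I J : Fin 3) :
    P.hessTangent i I J c = P.hessTangent i J I c := by
  rw [hessTangent, pd_comm P.isOpen_U P.smooth_Z hc, hessTangent]

theorem inner_pd_N_N (hc : c ∈ P.U) (K : Fin 3) : (inner ℝ (pd K P.N c) (P.N c) : ℝ) = 0 := by
  have hd := differentiableAt_of_contDiffOn P.isOpen_U P.smooth_N hc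
  have h := pd_inner hd hd K
  rw [pd_congr P.isOpen_U (fun x hx => P.inner_N_N hx) hc, pd_const] at h
  linarith

/-- Weingarten relation: differentiate the orthogonality of N and ∂_l Z. -/
theorem inner_pd_N_pd (hc : c ∈ P.U) (K : Fin 3) (l : Fin 2) :
    (inner ℝ (pd K P.N c) (pd l.succ P.Z c) : ℝ) = -P.hessNormal K l.succ c := by
  have h := pd_inner (differentiableAt_of_contDiffOn P.isOpen_U (P.contDiffOn_pd_Z l.succ) hc)
    (differentiableAt_of_contDiffOn P.isOpen_U P.smooth_N hc) K
  rw [pd_congr P.isOpen_U (fun x hx => P.orth_N x hx l) hc, pd_const] at h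
  rw [hessNormal]
  linarith

theorem pd_velocity (hc : c ∈ P.U) (K : Fin 3) :
    pd K (pd 0 P.Z) c = ∑ j, (pd K (P.v j) c • pd j.succ P.Z c
      + P.v j c • pd K (pd j.succ P.Z) c) + (pd K P.ν c • P.N c + P.ν c • pd K P.N c) := by
  have hv := fun j => differentiableAt_of_contDiffOn P.isOpen_U (P.contDiffOn_v j) hc
  have hz := fun j => differentiableAt_of_contDiffOn P.isOpen_U (P.contDiffOn_pd_Z j) hc
  have hν := differentiableAt_of_contDiffOn P.isOpen_U P.contDiffOn_ν hc
  have hN := differentiableAt_of_contDiffOn P.isOpen_U P.smooth_N hc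
  rw [pd_congr P.isOpen_U (f := pd 0 P.Z) (fun x hx => P.velocity_eq hx) hc,
    pd_add (DifferentiableAt.fun_sum fun j _ => (hv j).fun_smul (hz j.succ)) (hν.fun_smul hN),
    pd_sum _ fun j _ => (hv j).fun_smul (hz j.succ), pd_smul hν hN]
  simp only [pd_smul (hv _) (hz _)]

/-- Pair `pd_velocity` with N; the term with the derivative of N drops out since N has unit length.
-/
theorem hessNormal_zero (hc : c ∈ P.U) (K : Fin 3) :
    P.hessNormal K 0 c = ∑ j, P.v j c * P.hessNormal K j.succ c + pd K P.ν c := by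
  rw [hessNormal, P.pd_velocity hc, inner_add_left, inner_add_left, sum_inner]
  simp [inner_add_left, inner_smul_left, P.orth_N c hc, P.norm_N c hc, P.inner_pd_N_N hc,
    hessNormal]

/-- Pair `pd_velocity` with ∂_l Z and raise the index; the last term is the Weingarten contribution
of νN. -/
theorem hessTangent_zero (hc : c ∈ P.U) (i : Fin 2) (K : Fin 3) :
    P.hessTangent i K 0 c = pd K (P.v i) c + ∑ j, P.v j c * P.hessTangent i K j.succ c
      - P.ν c * ∑ l, P.gInv c i l * P.hessNormal K l.succ c := by
  have h : ∀ l : Fin 2, (inner ℝ (pd K (pd 0 P.Z) c) (pd l.succ P.Z c) : ℝ)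
      = ∑ j, P.g c l j * pd K (P.v j) c
        + ∑ j, P.v j c * inner ℝ (pd K (pd j.succ P.Z) c) (pd l.succ P.Z c)
        - P.ν c * P.hessNormal K l.succ c := fun l => by
    rw [P.pd_velocity hc, inner_add_left, inner_add_left, sum_inner]
    simp [inner_add_left, inner_smul_left, P.orth_N' hc, P.inner_pd_N_pd hc, inner_pd_pd,
      P.g_symm c l, mul_comm, sub_eq_add_neg, Finset.sum_add_distrib]
  simp only [hessTangent, h]
  rw [← P.sum_gInv_mul_sum_g hc (fun j => pd K (P.v j) c) i]
  simp only [Fin.sum_univ_two]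
  ring

theorem Γ_eq (hc : c ∈ P.U) (k i j : Fin 2) :
    P.Γ k i j c = P.hessTangent k i.succ j.succ c := by
  rw [Γ, hessTangent, Finset.mul_sum]
  refine Finset.sum_congr rfl fun l _ => ?_
  have h := christoffel_first_kind P.isOpen_U P.smooth_Z hc i.succ j.succ l.succ
  simp only [inner_pd_pd] at h
  rw [h]
  ring

/-- 𝓑 is the tangential part of the gradient of the full observer velocity v^i ∂_i Z + νN, which
explains the term -ν II beside ∇v. -/
theorem B_eq (hc : c ∈ P.U) (i j : Fin 2) : P.B i j c = P.hessTangent i j.succ 0 c := by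
  rw [P.hessTangent_zero hc, B, surfCov]
  have h : ∀ l, P.II l j c = P.hessNormal j.succ l.succ c := fun l => P.hessNormal_symm hc _ _
  simp only [P.Γ_eq hc, h, Finset.univ_unique, Finset.sum_singleton, Function.update_apply]
  simp [mul_comm]

/-! #### Spacetime metric and connection -/

theorem pd_X (hc : c ∈ P.U) (I : Fin 3) :
    pd I P.X c = WithLp.toLp 2 (if I = 0 then 1 else 0, pd I P.Z c) := by
  have hz := (differentiableAt_of_contDiffOn P.isOpen_U P.smooth_Z hc).hasFDerivAt
  have h0 : HasFDerivAt (fun x : Coord => x 0) (ContinuousLinearMap.proj (R := ℝ) 0) c :=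
    (ContinuousLinearMap.proj (R := ℝ) (φ := fun _ : Fin 3 => ℝ) 0).hasFDerivAt
  have h := ((WithLp.prodContinuousLinearEquiv 2 ℝ ℝ E3).symm :
    (ℝ × E3) →L[ℝ] E4).hasFDerivAt.comp c (h0.prodMk hz)
  have hX : P.X = ((WithLp.prodContinuousLinearEquiv 2 ℝ ℝ E3).symm : (ℝ × E3) →L[ℝ] E4) ∘
      fun x => (x 0, P.Z x) := rfl
  unfold pd
  rw [hX, h.fderiv]
  simp [Pi.single_apply, eq_comm]

theorem η_eq (hc : c ∈ P.U) (I J : Fin 3) :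
    P.η c I J = (if I = 0 then 1 else 0) * (if J = 0 then 1 else 0)
      + inner ℝ (pd I P.Z c) (pd J P.Z c) := by
  rw [η, Matrix.of_apply, P.pd_X hc, P.pd_X hc, WithLp.prod_inner_apply]
  simp [mul_comm]

theorem η_symm (c : Coord) (I J : Fin 3) : P.η c I J = P.η c J I :=
  real_inner_comm (pd J P.X c) (pd I P.X c)

theorem η_succ_succ (hc : c ∈ P.U) (i j : Fin 2) : P.η c i.succ j.succ = P.g c i j := by
  simp [P.η_eq hc, Fin.succ_ne_zero, inner_pd_pd]

theorem η_succ_zero (hc : c ∈ P.U) (i : Fin 2) :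
    P.η c i.succ 0 = ∑ j, P.g c i j * P.v j c := by
  rw [P.η_eq hc, ← P.inner_V_pd hc, real_inner_comm]
  simp [Fin.succ_ne_zero, V]

theorem η_zero_zero (hc : c ∈ P.U) :
    P.η c 0 0 = 1 + P.ν c ^ 2 + ∑ i, P.v i c * ∑ j, P.g c i j * P.v j c := by
  have h : (inner ℝ (pd 0 P.Z c) (pd 0 P.Z c) : ℝ)
      = inner ℝ (P.V c) (∑ j, P.v j c • pd j.succ P.Z c + P.ν c • P.N c) := by
    rw [← P.velocity_eq hc]; rfl
  rw [P.η_eq hc, h, inner_add_right, inner_sum]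
  simp only [inner_smul_right, P.inner_V_pd hc]
  change _ + (_ + P.ν c * P.ν c) = _
  simp only [if_true]
  ring

/-- As a vector of ℝ⁴, τ = (1, νN): it is orthogonal to ∂_i X and has product 1 + ν² with ∂_t X. -/
theorem τFlat_eq (hc : c ∈ P.U) (I : Fin 3) :
    P.τFlat I c = if I = 0 then 1 + P.ν c ^ 2 else 0 := by
  rw [τFlat, Fin.sum_univ_succ]
  refine Fin.cases ?_ (fun i => ?_) I
  · simp only [τ, Fin.cases_zero, Fin.cases_succ, P.η_zero_zero hc, P.η_symm c 0 (Fin.succ _),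
      P.η_succ_zero hc, if_true, Fin.sum_univ_two]
    ring
  · simp only [τ, Fin.cases_zero, Fin.cases_succ, P.η_succ_zero hc, P.η_succ_succ hc,
      Fin.succ_ne_zero, if_false, Fin.sum_univ_two]
    ring

theorem ζ_mul (c : Coord) : P.ζ c * (1 + P.ν c ^ 2) = 1 := by
  have : 1 + P.ν c ^ 2 ≠ 0 := by positivity
  rw [ζ]
  field_simp

/-- Among the ∂_I X only ∂_t X has a time component, so its coefficient in a vanishing combination
is zero; the immersion property handles the others. -/
theorem det_η_ne_zero (hc : c ∈ P.U) : (P.η c).det ≠ 0 := by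
  refine Matrix.det_gram_ne_zero_iff_linearIndependent.2
    (Fintype.linearIndependent_iff.2 fun w hw => ?_)
  simp only [P.pd_X hc] at hw
  have h1 := congrArg (fun x : E4 => x.fst) hw
  have h2 := congrArg (fun x : E4 => x.snd) hw
  rw [Fin.sum_univ_succ] at h1 h2
  simp [Fin.sum_univ_two] at h1 h2
  rw [h1, zero_smul, zero_add] at h2
  have h3 := Fintype.linearIndependent_iff.1 (P.immersion c hc) (fun i => w i.succ)
    (by simpa [Fin.sum_univ_two] using h2)
  exact Fin.cases h1 h3

/-- The right side is the tangential projection of (0, ∂_I ∂_J Z) in coordinates. Since η is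
invertible, it suffices to compare products with each ∂_L X. -/
theorem γ_eq (hc : c ∈ P.U) (K I J : Fin 3) :
    P.γ K I J c = P.ζ c * P.ν c * P.hessNormal I J c * P.τ K c
      + ∑ i : Fin 2, P.hessTangent i I J c * (if K = i.succ then 1 else 0) := by
  set w : Fin 3 → ℝ := fun K => P.ζ c * P.ν c * P.hessNormal I J c * P.τ K c
      + ∑ i : Fin 2, P.hessTangent i I J c * (if K = i.succ then 1 else 0) with hw
  -- The time part of η is constant, so the first-kind symbols are those of the form induced by Z
  -- alone.
  have h1 : ∀ L, (1 / 2) * (pd I (fun x => P.η x J L) c + pd J (fun x => P.η x I L) c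
      - pd L (fun x => P.η x I J) c) = inner ℝ (pd I (pd J P.Z) c) (pd L P.Z c) := by
    intro L
    have hη : ∀ A B C : Fin 3, pd C (fun x => P.η x A B) c
        = pd C (fun x => (inner ℝ (pd A P.Z x) (pd B P.Z x) : ℝ)) c := fun A B C => by
      have hd : DifferentiableAt ℝ (fun x => (inner ℝ (pd A P.Z x) (pd B P.Z x) : ℝ)) c :=
        differentiableAt_of_contDiffOn P.isOpen_U
          ((P.contDiffOn_pd_Z A).inner ℝ (P.contDiffOn_pd_Z B)) hc
      rw [pd_congr P.isOpen_U (fun x hx => P.η_eq hx A B) hc,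
        pd_add (differentiableAt_const _) hd, pd_const, zero_add]
    rw [hη, hη, hη, christoffel_first_kind P.isOpen_U P.smooth_Z hc]
    ring
  have h2 : ∀ L, ∑ K, P.η c L K * w K = inner ℝ (pd I (pd J P.Z) c) (pd L P.Z c) := by
    intro L
    have h3 : ∑ K, P.η c L K * w K = P.ζ c * P.ν c * P.hessNormal I J c * P.τFlat L c
        + ∑ i : Fin 2, P.η c L i.succ * P.hessTangent i I J c := by
      simp only [hw, τFlat, Fin.sum_univ_succ, Finset.univ_unique,
        Finset.sum_singleton, Fin.succ_inj, (Fin.succ_ne_zero _).symm, if_false]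
      simp
      ring
    have ht : ∀ l : Fin 2, ∑ i : Fin 2, P.g c l i * P.hessTangent i I J c
        = inner ℝ (pd I (pd J P.Z) c) (pd l.succ P.Z c) :=
      P.sum_g_mul_sum_gInv hc fun l => inner ℝ (pd I (pd J P.Z) c) (pd l.succ P.Z c)
    rw [h3, P.τFlat_eq hc]
    refine Fin.cases ?_ (fun l => ?_) L
    -- In the time row the N-part of the velocity contributes ν times the normal component; it
    -- matches because ζ(1 + ν²) = 1.
    · have hV : pd 0 P.Z c = _ := P.velocity_eq hc
      rw [hV, inner_add_right, inner_sum, inner_smul_right, ← hessNormal]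
      simp only [inner_smul_right, ← ht, P.η_symm c 0 (Fin.succ _), P.η_succ_zero hc, if_true,
        Fin.sum_univ_two, P.g_symm c 1 0]
      linear_combination P.ν c * P.hessNormal I J c * P.ζ_mul c
    · simp only [Fin.succ_ne_zero, if_false, mul_zero, zero_add, P.η_succ_succ hc]
      exact ht l
  have h4 : P.ηInv c * P.η c = 1 :=
    Matrix.nonsing_inv_mul _ (isUnit_iff_ne_zero.2 (P.det_η_ne_zero hc))
  have h5 := congrFun (congrArg (fun A => A.mulVec w) h4) K
  rw [← Matrix.mulVec_mulVec, Matrix.one_mulVec] at h5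
  change _ = w K
  rw [← h5, γ, Finset.mul_sum]
  change _ = ∑ L, P.ηInv c K L * ∑ K, P.η c L K * w K
  refine Finset.sum_congr rfl fun L _ => ?_
  rw [mul_left_comm, h1, ← h2]

end ObserverPatch

/-! ### Sums of products over multi-indices -/

section MultiIndex

variable {n : ℕ} {ι : Type*}

theorem prod_ite_slot (β : Fin n) (F G : Fin n → ℝ) :
    ∏ s, (if s = β then F s else G s) = F β * ∏ s ∈ Finset.univ.erase β, G s := by
  rw [← Finset.mul_prod_erase _ _ (Finset.mem_univ β), if_pos rfl]
  congr 1
  exact Finset.prod_congr rfl fun s hs => if_neg (Finset.ne_of_mem_erase hs)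

/-- Distributivity reduces a change of basis on n slots to a contraction in each slot separately. -/
theorem sum_prod_mul_sum_prod [Fintype ι] (A : Fin n → ι → ℝ) (B : Fin n → ι → ι → ℝ)
    (ρ : (Fin n → ι) → ℝ) :
    ∑ J : Fin n → ι, (∏ s, A s (J s)) * ∑ b : Fin n → ι, ρ b * ∏ s, B s (J s) (b s)
      = ∑ b : Fin n → ι, ρ b * ∏ s, ∑ x, A s x * B s x (b s) := by
  simp only [Fintype.prod_sum, Finset.mul_sum]
  rw [Finset.sum_comm]
  refine Finset.sum_congr rfl fun b _ => Finset.sum_congr rfl fun J _ => ?_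
  rw [Finset.prod_mul_distrib]
  ring

theorem prod_kronecker [DecidableEq ι] (a b : Fin n → ι) :
    ∏ s, (if a s = b s then (1 : ℝ) else 0) = if a = b then 1 else 0 := by
  rw [Finset.prod_boole]
  simp [funext_iff]

theorem sum_mul_prod_kronecker [Fintype ι] [DecidableEq ι] (ρ : (Fin n → ι) → ℝ) (a : Fin n → ι) :
    ∑ b : Fin n → ι, ρ b * ∏ s, (if a s = b s then (1 : ℝ) else 0) = ρ a := by
  simp only [prod_kronecker]
  simp

/-- The Kronecker factors leave only those b that agree with a outside β. -/
theorem sum_mul_prod_ite_kronecker [Fintype ι] [DecidableEq ι] (ρ : (Fin n → ι) → ℝ)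
    (a : Fin n → ι) (β : Fin n) (w : ι → ℝ) :
    ∑ b : Fin n → ι, ρ b * ∏ s, (if s = β then w (b s) else if a s = b s then (1 : ℝ) else 0)
      = ∑ x, w x * ρ (Function.update a β x) := by
  have h : ∀ b : Fin n → ι,
      ∏ s, (if s = β then w (b s) else if a s = b s then (1 : ℝ) else 0)
        = ∑ x, w x * ∏ s, (if Function.update a β x s = b s then (1 : ℝ) else 0) := fun b => by
    have h' : ∀ x, ∏ s, (if Function.update a β x s = b s then (1 : ℝ) else 0)
        = (if x = b β then 1 else 0)
          * ∏ s ∈ Finset.univ.erase β, (if a s = b s then (1 : ℝ) else 0) := fun x => by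
      rw [← Finset.mul_prod_erase _ _ (Finset.mem_univ β), Function.update_self]
      congr 1
      exact Finset.prod_congr rfl fun s hs => by
        rw [Function.update_of_ne (Finset.ne_of_mem_erase hs)]
    simp only [h', prod_ite_slot]
    simp
  simp only [h, Finset.mul_sum]
  rw [Finset.sum_comm]
  refine Finset.sum_congr rfl fun x _ => ?_
  simp only [mul_left_comm _ (w x), ← Finset.mul_sum, sum_mul_prod_kronecker]

end MultiIndex

/-! ### The adapted frame of the spacetime surface -/

namespace ObserverPatch

variable (P : ObserverPatch) {c : Coord}

/-- Components of the frame `τ, ∂_1 X, ∂_2 X` of the spacetime surface. -/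
def frame (I a : Fin 3) (c : Coord) : ℝ :=
  Fin.cases (P.τ I c) (fun j => if I = j.succ then 1 else 0) a

/-- Components of the dual frame. -/
def coframe (a J : Fin 3) (c : Coord) : ℝ :=
  Fin.cases (if J = 0 then 1 else 0)
    (fun i => Fin.cases (P.v i c) (fun j => if i = j then 1 else 0) J) a

theorem coframe_mul_frame (c : Coord) (a b : Fin 3) :
    ∑ I, P.coframe a I c * P.frame I b c = if a = b then 1 else 0 := by
  rw [Fin.sum_univ_succ]
  refine Fin.cases ?_ (fun i => ?_) a <;> refine Fin.cases ?_ (fun j => ?_) b <;>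
    simp [coframe, frame, τ, Fin.succ_ne_zero, (Fin.succ_ne_zero _).symm]

theorem frame_mul_coframe (c : Coord) (I J : Fin 3) :
    ∑ a, P.frame I a c * P.coframe a J c = if I = J then 1 else 0 := by
  rw [Fin.sum_univ_succ]
  refine Fin.cases ?_ (fun i => ?_) I <;> refine Fin.cases ?_ (fun j => ?_) J <;>
    simp [coframe, frame, τ, Fin.succ_ne_zero, (Fin.succ_ne_zero _).symm]

theorem contDiffOn_frame (I a : Fin 3) : ContDiffOn ℝ ∞ (P.frame I a) P.U := by
  refine Fin.cases ?_ (fun j => ?_) a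
  · refine Fin.cases ?_ (fun i => ?_) I
    · exact contDiffOn_const
    · exact (P.contDiffOn_v i).neg
  · exact contDiffOn_const

/-! #### The connection in the frame -/

variable (vm : Fin 2 → Coord → ℝ)

/-- Components of `∇_{τ_𝔪}` of the frame fields with respect to the frame. -/
def connForm (b a : Fin 3) (c : Coord) : ℝ :=
  Fin.cases
    (Fin.cases (P.ζ c * P.ν c * P.dot vm P.ν c) (fun k => P.ζ c * P.ν c * P.bm vm k c) a)
    (fun i => Fin.cases (-(P.ν c * P.bmSharp vm i c))
      (fun j => ∑ k, P.u vm k c * P.Γ i k j c + P.B i j c) a) b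

theorem sum_τm (f : Fin 3 → ℝ) (c : Coord) :
    ∑ K, P.τm vm K c * f K = f 0 + ∑ k : Fin 2, P.u vm k c * f k.succ := by
  rw [Fin.sum_univ_succ]
  simp [τm]

/-- The observer velocity cancels, since u + v is the material velocity: b_𝔪 consists of the normal
components of the material derivatives of ∂_l Z. -/
theorem sum_τm_mul_hessNormal (hc : c ∈ P.U) (l : Fin 2) :
    ∑ K, P.τm vm K c * P.hessNormal K l.succ c = P.bm vm l c := by
  have h : ∀ j : Fin 2, P.II l j c = P.hessNormal l.succ j.succ c := fun _ => rfl
  rw [sum_τm, P.hessNormal_symm hc 0, P.hessNormal_zero hc, bm]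
  simp only [h, u, Fin.sum_univ_two, P.hessNormal_symm hc _ l.succ]
  ring

/-- For ∂_j X the components are constant, so this is `γ_eq`. For τ the derivatives of v and all
terms with v^j cancel, leaving the gradient of ν and the Weingarten term. -/
theorem cov_frame (hc : c ∈ P.U) (I K a : Fin 3) :
    pd K (P.frame I a) c + ∑ J, P.γ I K J c * P.frame J a c
      = P.frame I 0 c * (P.ζ c * P.ν c *
          Fin.cases (pd K P.ν c) (fun j => P.hessNormal K j.succ c) a)
        + ∑ i : Fin 2, P.frame I i.succ c *
          Fin.cases (-(P.ν c * ∑ l, P.gInv c i l * P.hessNormal K l.succ c))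
            (fun j => P.hessTangent i K j.succ c) a := by
  refine Fin.cases ?_ (fun j => ?_) a
  · have h0 := P.hessNormal_zero hc K
    have hT := fun i => P.hessTangent_zero hc i K
    have hp : pd K (P.frame I 0) c = - ∑ i : Fin 2, P.frame I i.succ c * pd K (P.v i) c := by
      refine Fin.cases ?_ (fun i => ?_) I
      · have : P.frame 0 0 = fun _ => 1 := rfl
        rw [this, pd_const]
        simp [frame, (Fin.succ_ne_zero _).symm]
      · have : P.frame i.succ 0 = fun x => -P.v i x := rfl
        rw [this]
        simp [frame, pd]
    rw [hp, Fin.sum_univ_succ (n := 2)]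
    simp only [P.γ_eq hc, h0, hT, Fin.sum_univ_two, Fin.cases_zero]
    simp only [frame, τ, Fin.cases_zero, Fin.cases_succ]
    ring
  · have hp : pd K (P.frame I j.succ) c = 0 := pd_const K _
    rw [hp, Finset.sum_eq_single j.succ (fun b _ hb => ?_) (by simp)]
    · simp only [P.γ_eq hc, Fin.cases_succ]
      simp only [frame, Fin.cases_zero, Fin.cases_succ, if_true, Fin.sum_univ_two]
      ring
    · simp [frame, hb]

theorem cov_frame_along (hc : c ∈ P.U) (I a : Fin 3) :
    ∑ K, P.τm vm K c * (pd K (P.frame I a) c + ∑ J, P.γ I K J c * P.frame J a c)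
      = ∑ b, P.frame I b c * P.connForm vm b a c := by
  have hb := P.sum_τm_mul_hessNormal vm hc
  simp only [P.cov_frame hc]
  rw [Fin.sum_univ_succ (fun b => P.frame I b c * P.connForm vm b a c)]
  refine Fin.cases ?_ (fun j => ?_) a
  · have h2 : P.dot vm P.ν c = ∑ K, P.τm vm K c * pd K P.ν c := by rw [sum_τm, dot]
    simp only [connForm, Fin.cases_zero, Fin.cases_succ, bmSharp, ← hb, h2]
    simp only [Fin.sum_univ_two, Fin.sum_univ_three]
    ring
  -- By symmetry of second derivatives, 𝓑 supplies the time summand of the contraction with τ_𝔪, and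
  -- the Γ-terms supply the spatial ones.
  · have h2 : ∀ i, ∑ k, P.u vm k c * P.Γ i k j c + P.B i j c
        = ∑ K, P.τm vm K c * P.hessTangent i K j.succ c := fun i => by
      simp only [P.Γ_eq hc]
      rw [P.B_eq hc, sum_τm, P.hessTangent_symm hc i 0, add_comm]
    simp only [connForm, Fin.cases_zero, Fin.cases_succ, h2, ← hb]
    simp only [Fin.sum_univ_two, Fin.sum_univ_three]
    ring

/-! #### Tensors in the frame -/

variable {n : ℕ}

/-- Components of a spacetime tensor field with respect to the frame. -/
def comp (R : SpacetimeTensor n) : SpacetimeTensor n := fun a c =>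
  ∑ J : Fin n → Fin 3, (∏ s, P.coframe (a s) (J s) c) * R J c

/-- The spacetime tensor field with given components with respect to the frame. -/
def expand (ρ : SpacetimeTensor n) : SpacetimeTensor n := fun I c =>
  ∑ a : Fin n → Fin 3, ρ a c * ∏ s, P.frame (I s) (a s) c

theorem expand_comp (R : SpacetimeTensor n) (I : Fin n → Fin 3) (c : Coord) :
    P.expand (P.comp R) I c = R I c := by
  have h := sum_prod_mul_sum_prod (fun s a => P.frame (I s) a c)
    (fun _ a J => P.coframe a J c) (fun J => R J c)
  simp only [P.frame_mul_coframe] at h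
  rw [sum_mul_prod_kronecker (fun J => R J c)] at h
  rw [← h, expand]
  refine Finset.sum_congr rfl fun a _ => ?_
  rw [mul_comm, comp]
  exact congrArg _ (Finset.sum_congr rfl fun J _ => mul_comm _ _)

theorem pd_expand {ρ : SpacetimeTensor n} (hρ : ∀ a, ContDiffOn ℝ ∞ (ρ a) P.U)
    (hc : c ∈ P.U) (I : Fin n → Fin 3) (K : Fin 3) :
    pd K (P.expand ρ I) c = ∑ a : Fin n → Fin 3, (pd K (ρ a) c * ∏ s, P.frame (I s) (a s) c
      + ρ a c * ∑ β, pd K (P.frame (I β) (a β)) c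
          * ∏ s ∈ Finset.univ.erase β, P.frame (I s) (a s) c) := by
  have hd : ∀ I a, DifferentiableAt ℝ (P.frame I a) c := fun I a =>
    differentiableAt_of_contDiffOn P.isOpen_U (P.contDiffOn_frame I a) hc
  have hp : ∀ a : Fin n → Fin 3,
      DifferentiableAt ℝ (fun x => ∏ s, P.frame (I s) (a s) x) c := fun a =>
    differentiableAt_of_contDiffOn P.isOpen_U
      (contDiffOn_prod fun s _ => P.contDiffOn_frame (I s) (a s)) hc
  have hr : ∀ a, DifferentiableAt ℝ (ρ a) c := fun a =>
    differentiableAt_of_contDiffOn P.isOpen_U (hρ a) hc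
  have hs : ∀ a ∈ (Finset.univ : Finset (Fin n → Fin 3)),
      DifferentiableAt ℝ (fun x => ρ a x * ∏ s, P.frame (I s) (a s) x) c :=
    fun a _ => (hr a).fun_mul (hp a)
  have h1 := pd_sum Finset.univ hs K
  refine h1.trans (Finset.sum_congr rfl fun a _ => ?_)
  refine (pd_smul (hr a) (hp a) K).trans ?_
  rw [pd_prod fun s => hd (I s) (a s)]
  simp only [smul_eq_mul]
  congr 2
  exact Finset.sum_congr rfl fun β _ =>
    prod_ite_slot β (fun _ => pd K (P.frame (I β) (a β)) c) _

theorem sum_mul_expand_update (ρ : SpacetimeTensor n) (w : Fin 3 → ℝ) (I : Fin n → Fin 3)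
    (β : Fin n) (c : Coord) :
    ∑ J, w J * P.expand ρ (Function.update I β J) c = ∑ a : Fin n → Fin 3,
      ρ a c * ((∑ J, w J * P.frame J (a β) c)
        * ∏ s ∈ Finset.univ.erase β, P.frame (I s) (a s) c) := by
  simp only [expand, Finset.mul_sum, Finset.sum_mul]
  rw [Finset.sum_comm]
  refine Finset.sum_congr rfl fun a _ => Finset.sum_congr rfl fun J _ => ?_
  rw [← Finset.mul_prod_erase _ _ (Finset.mem_univ β), Function.update_self,
    Finset.prod_congr rfl fun s hs => by
      rw [Function.update_of_ne (Finset.ne_of_mem_erase hs)]]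
  ring

/-- At each slot the coordinate derivative of the frame factor and the Christoffel term combine into
the covariant derivative of that frame field, which `cov_frame_along` evaluates. -/
theorem stMaterial_expand {ρ : SpacetimeTensor n} (hρ : ∀ a, ContDiffOn ℝ ∞ (ρ a) P.U)
    (hc : c ∈ P.U) (I : Fin n → Fin 3) :
    P.stMaterial vm (P.expand ρ) I c
      = ∑ a : Fin n → Fin 3, P.dot vm (ρ a) c * ∏ s, P.frame (I s) (a s) c
        + ∑ β, ∑ a : Fin n → Fin 3, ρ a c * ∏ s, if s = β then
            ∑ b, P.frame (I s) b c * P.connForm vm b (a s) c else P.frame (I s) (a s) c := by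
  have hdot : ∀ a, P.dot vm (ρ a) c = ∑ K, P.τm vm K c * pd K (ρ a) c := fun a => by
    rw [sum_τm, dot]
  simp only [stMaterial, stCov, P.pd_expand hρ hc, P.sum_mul_expand_update, prod_ite_slot,
    ← P.cov_frame_along vm hc, hdot]
  rw [Finset.sum_comm (s := (Finset.univ : Finset (Fin n)))
    (t := (Finset.univ : Finset (Fin n → Fin 3))), ← Finset.sum_add_distrib]
  have h : ∀ K, ∑ β, ∑ a : Fin n → Fin 3, ρ a c * ((∑ J, P.γ (I β) K J c * P.frame J (a β) c)
        * ∏ s ∈ Finset.univ.erase β, P.frame (I s) (a s) c)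
      = ∑ a : Fin n → Fin 3, ∑ β, ρ a c * ((∑ J, P.γ (I β) K J c * P.frame J (a β) c)
        * ∏ s ∈ Finset.univ.erase β, P.frame (I s) (a s) c) := fun K => Finset.sum_comm
  simp only [h, ← Finset.sum_add_distrib]
  simp only [Finset.mul_sum (s := (Finset.univ : Finset (Fin n → Fin 3)))]
  rw [Finset.sum_comm]
  refine Finset.sum_congr rfl fun a _ => ?_
  simp only [Finset.mul_sum (s := (Finset.univ : Finset (Fin n))), add_assoc,
    ← Finset.sum_add_distrib, mul_add (P.τm vm _ c), Finset.sum_mul]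
  simp only [mul_add, add_mul, Finset.sum_add_distrib, Finset.mul_sum, Finset.sum_mul]
  rw [Finset.sum_comm (s := (Finset.univ : Finset (Fin 3))) (t := (Finset.univ : Finset (Fin n))),
    Finset.sum_comm (s := (Finset.univ : Finset (Fin 3))) (t := (Finset.univ : Finset (Fin n)))]
  congr 1
  · exact Finset.sum_congr rfl fun _ _ => by ring
  · congr 1
    · exact Finset.sum_congr rfl fun _ _ => Finset.sum_congr rfl fun _ _ => by ring
    · exact Finset.sum_congr rfl fun _ _ => Finset.sum_congr rfl fun _ _ =>
        Finset.sum_congr rfl fun _ _ => by ring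

/-- The material derivative in the frame. -/
theorem comp_stMaterial_expand {ρ : SpacetimeTensor n} (hρ : ∀ a, ContDiffOn ℝ ∞ (ρ a) P.U)
    (hc : c ∈ P.U) (a : Fin n → Fin 3) :
    P.comp (P.stMaterial vm (P.expand ρ)) a c = P.dot vm (ρ a) c
      + ∑ β, ∑ b, P.connForm vm (a β) b c * ρ (Function.update a β b) c := by
  simp only [comp, P.stMaterial_expand vm hρ hc, mul_add, Finset.sum_add_distrib]
  congr 1
  · rw [sum_prod_mul_sum_prod (fun s J => P.coframe (a s) J c) (fun _ J b => P.frame J b c)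
      (fun b => P.dot vm (ρ b) c)]
    simp only [P.coframe_mul_frame]
    exact sum_mul_prod_kronecker (fun b => P.dot vm (ρ b) c) a
  · simp only [Finset.mul_sum (s := (Finset.univ : Finset (Fin n)))]
    rw [Finset.sum_comm]
    refine Finset.sum_congr rfl fun β _ => ?_
    rw [sum_prod_mul_sum_prod (fun s J => P.coframe (a s) J c)
      (fun s J b => if s = β then ∑ d, P.frame J d c * P.connForm vm d b c else P.frame J b c)
      (fun b => ρ b c)]
    rw [← sum_mul_prod_ite_kronecker (fun b => ρ b c) a β
      (fun b => P.connForm vm (a β) b c)]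
    refine Finset.sum_congr rfl fun b _ => congrArg _ (Finset.prod_congr rfl fun s _ => ?_)
    -- Coframe against frame is the identity in every slot but β, where the matrix entry remains.
    by_cases h : s = β
    · subst h
      simp only [if_true, Finset.mul_sum, ← mul_assoc]
      rw [Finset.sum_comm]
      simp only [← Finset.sum_mul, P.coframe_mul_frame]
      simp
    · simp only [h, if_false, P.coframe_mul_frame]

/-! #### The decomposition in the frame -/

/-- Components of `⟦r⟧⁻¹` with respect to the frame. -/
def frameComp (r : BundleTensor n) : SpacetimeTensor n := fun a c =>
  ∑ σ : Shuffle n, if ∀ k, a (σ.front k) = 0 then cutInv (r σ) (fun l => a (σ.rear l)) c else 0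

/-- Another shuffle could contribute only if its transversal slots were exactly the zeros of the
multi-index, which would make it equal to σ. -/
theorem frameComp_multi (r : BundleTensor n) (σ : Shuffle n) (i : Fin σ.m → Fin 2) :
    frameComp r (σ.multi i) = r σ i := by
  funext c
  rw [frameComp, Finset.sum_eq_single σ (fun σ' _ hσ => ?_) (by simp)]
  · simp [cutInv, Fin.succ_ne_zero]
  · split_ifs with h1
    · rw [cutInv, dif_neg]
      intro h2
      refine hσ (Shuffle.ext_transSet (Finset.ext fun s => ?_))
      rw [σ.mem_transSet_iff_multi i]
      refine σ'.forall_slot (p := fun s => s ∈ σ'.transSet ↔ σ.multi i s = 0) (fun k => ?_)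
        (fun l => ?_) s
      · simp [σ'.front_mem, h1]
      · simp [σ'.rear_notMem, h2]
    · rfl

theorem contDiffOn_frameComp {r : BundleTensor n} {U : Set Coord}
    (hr : ∀ σ i, ContDiffOn ℝ ∞ (r σ i) U) (a : Fin n → Fin 3) :
    ContDiffOn ℝ ∞ (frameComp r a) U := by
  obtain ⟨σ, i, rfl⟩ := Shuffle.exists_eq_multi a
  rw [frameComp_multi]
  exact hr σ i

/-- A spatial frame index gives a Kronecker delta, so only frame indices that copy I on the
instantaneous slots survive. -/
theorem bracketInv_eq_expand (r : BundleTensor n) :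
    P.bracketInv r = P.expand (frameComp r) := by
  funext I c
  simp only [bracketInv, expand, frameComp, Finset.sum_mul]
  rw [Finset.sum_comm]
  refine Finset.sum_congr rfl fun σ _ => ?_
  rw [Finset.sum_eq_single (σ.join (fun _ => 0) fun l => I (σ.rear l)) (fun a _ ha => ?_)
    (by simp), σ.prod_slot]
  · simp only [Shuffle.join_front, Shuffle.join_rear, implies_true, if_true, φInv]
    by_cases h : ∀ l, I (σ.rear l) ≠ 0
    · have h1 : ∀ l, P.frame (I (σ.rear l)) (I (σ.rear l)) c = 1 := fun l => by
        obtain ⟨j, hj⟩ := Fin.exists_succ_eq.2 (h l)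
        simp [← hj, frame]
      simp only [h1, Finset.prod_const_one, mul_one]
      exact mul_comm _ _
    · rw [cutInv, dif_neg h]
      simp
  · split_ifs with h1
    · by_cases h2 : ∀ l, a (σ.rear l) ≠ 0
      · have h3 : ∃ l, a (σ.rear l) ≠ I (σ.rear l) := by
          by_contra! h3
          exact ha (σ.eq_join h1 h3)
        obtain ⟨l, hl⟩ := h3
        obtain ⟨j, hj⟩ := Fin.exists_succ_eq.2 (h2 l)
        have h4 : P.frame (I (σ.rear l)) (a (σ.rear l)) c = 0 := by
          rw [← hj] at hl ⊢
          simp [frame, hl.symm]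
        rw [Finset.prod_eq_zero (Finset.mem_univ (σ.rear l)) h4, mul_zero]
      · rw [cutInv, dif_neg h2, zero_mul]
    · rw [zero_mul]

theorem projTrans_zero (hc : c ∈ P.U) (J : Fin 3) : P.projTrans 0 J c = P.coframe 0 J c := by
  have h := P.ζ_mul c
  rw [projTrans, P.τFlat_eq hc]
  by_cases hJ : J = 0 <;> simp [hJ, τ, coframe, h]

/-- Since ζτ_J is the time differential, the spatial row of the projector is dy^i + v^i dt, the dual
form to ∂_i X. -/
theorem projInst_succ (hc : c ∈ P.U) (i : Fin 2) (J : Fin 3) :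
    P.projInst i.succ J c = P.coframe i.succ J c := by
  have h := P.ζ_mul c
  rw [projInst, projTrans, P.τFlat_eq hc]
  refine Fin.cases ?_ (fun j => ?_) J
  · simp only [Fin.succ_ne_zero, if_false, if_true, τ, coframe, Fin.cases_zero, Fin.cases_succ]
    linear_combination P.v i c * h
  · simp [Fin.succ_ne_zero, coframe]

/-- `τFlat` sees only the time entry, where its α factors 1 + ν² cancel ζ^α. What is left are the
projector rows already identified with the coframe. -/
theorem bracket_eq_comp (hc : c ∈ P.U) (R : SpacetimeTensor n) (σ : Shuffle n)
    (i : Fin σ.m → Fin 2) : P.bracket R σ i c = P.comp R (σ.multi i) c := by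
  rw [bracket, cut, φ, Finset.sum_eq_single (fun _ => 0) (fun J _ hJ => ?_) (by simp)]
  · have h : P.ζ c ^ σ.α * ∏ _k : Fin σ.α, P.τFlat 0 c = 1 := by
      simp [P.τFlat_eq hc, ← mul_pow, P.ζ_mul]
    rw [h, one_mul, shuffleProj, comp]
    refine Finset.sum_congr rfl fun J _ => ?_
    simp only [σ.prod_slot, Shuffle.join_front, Shuffle.join_rear, Shuffle.multi_front,
      Shuffle.multi_rear, P.projTrans_zero hc, P.projInst_succ hc]
  · obtain ⟨k, hk⟩ := Function.ne_iff.1 hJ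
    have h : P.τFlat (J k) c = 0 := by rw [P.τFlat_eq hc, if_neg hk]
    rw [Finset.prod_eq_zero (Finset.mem_univ k) h]
    simp

theorem frameComp_bracket (hc : c ∈ P.U) (R : SpacetimeTensor n) (a : Fin n → Fin 3) :
    frameComp (P.bracket R) a c = P.comp R a c := by
  obtain ⟨σ, i, rfl⟩ := Shuffle.exists_eq_multi a
  rw [frameComp_multi, P.bracket_eq_comp hc]

/-- Reading off all frame components and expanding again loses nothing, whatever the tensor field.
-/
theorem bracketInv_bracket (hc : c ∈ P.U) (R : SpacetimeTensor n) (I : Fin n → Fin 3) :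
    P.bracketInv (P.bracket R) I c = R I c := by
  rw [bracketInv_eq_expand, ← P.expand_comp R I c]
  simp only [expand, P.frameComp_bracket hc]

theorem material_eq (hc : c ∈ P.U) {r : BundleTensor n}
    (hr : ∀ σ i, ContDiffOn ℝ ∞ (r σ i) P.U) (σ : Shuffle n) (i : Fin σ.m → Fin 2) :
    P.material vm r σ i c = pd 0 (r σ i) c + P.surfCovAlong vm (r σ) i c
      + σ.α * P.ζ c * P.ν c * P.dot vm P.ν c * r σ i c
      + P.ζ c * P.ν c * ∑ k, P.bm vm k c *
          ∑ β : Fin σ.α, r (σ.raise β) ((σ.bar β).insertNth k i) c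
      + ∑ β : Fin σ.m, ((∑ k, P.B (i β) k c * r σ (Function.update i β k) c)
          - P.ν c * P.bmSharp vm (i β) c * r (σ.lower β) (omitAt β i) c) := by
  have hraise : ∀ β k, frameComp r ((σ.raise β).multi ((σ.bar β).insertNth k i))
      = r (σ.raise β) ((σ.bar β).insertNth k i) := fun β k => frameComp_multi r (σ.raise β) _
  have hlower : ∀ β, frameComp r ((σ.lower β).multi (omitAt β i))
      = r (σ.lower β) (omitAt β i) := fun β => frameComp_multi r (σ.lower β) _
  rw [material, P.bracket_eq_comp hc, bracketInv_eq_expand,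
    P.comp_stMaterial_expand vm (contDiffOn_frameComp hr) hc, σ.sum_slot]
  -- Splitting each matrix row into its time and spatial entries separates the terms that keep σ
  -- from those that change it.
  simp only [Fin.sum_univ_succ (fun b : Fin 3 => P.connForm vm _ b c * _),
    σ.update_multi_front_zero, σ.update_multi_front_succ, σ.update_multi_rear_zero,
    σ.update_multi_rear_succ, hraise, hlower, frameComp_multi, Shuffle.multi_front, Shuffle.multi_rear]
  -- The α transversal slots contribute equal diagonal terms, hence the factor α; the Γ-part on the
  -- instantaneous slots completes u^k ∂_k to ∇_u.
  simp only [connForm, Fin.cases_zero, Fin.cases_succ, dot, surfCovAlong, surfCov,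
    Fin.sum_univ_two, Finset.sum_add_distrib, Finset.sum_sub_distrib, Finset.mul_sum, add_mul,
    mul_add, Finset.sum_const, Finset.card_univ, Fintype.card_fin, nsmul_eq_mul, neg_mul,
    Finset.sum_neg_distrib, mul_assoc]
  ring

end ObserverPatch

end MovingSurface

end

theorem theorem1 (P : MovingSurface.ObserverPatch)
    (vm : Fin 2 → MovingSurface.Coord → ℝ) (hvm : ∀ i, ContDiffOn ℝ ∞ (vm i) P.U)
    (n : ℕ) (r : MovingSurface.BundleTensor n)
    (hr : ∀ (σ : MovingSurface.Shuffle n) (i : Fin σ.m → Fin 2), ContDiffOn ℝ ∞ (r σ i) P.U) :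
    -- the components of the material derivative are again smooth surface tensor fields
    (∀ (σ : MovingSurface.Shuffle n) (i : Fin σ.m → Fin 2),
      ContDiffOn ℝ ∞ (P.material vm r σ i) P.U) ∧
    -- the spacetime covariant derivative is the sum of its components over all shuffles
    (∀ (I : Fin n → Fin 3), ∀ c ∈ P.U,
      P.stMaterial vm (P.bracketInv r) I c = P.bracketInv (P.material vm r) I c) ∧
    -- the components
    (∀ (σ : MovingSurface.Shuffle n) (i : Fin σ.m → Fin 2), ∀ c ∈ P.U,
      P.material vm r σ i c =
        MovingSurface.pd 0 (r σ i) c + P.surfCovAlong vm (r σ) i c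
          + σ.α * P.ζ c * P.ν c * P.dot vm P.ν c * r σ i c
          + P.ζ c * P.ν c * ∑ k, P.bm vm k c *
              ∑ β : Fin σ.α, r (σ.raise β) ((σ.bar β).insertNth k i) c
          + ∑ β : Fin σ.m,
              ((∑ k, P.B (i β) k c * r σ (Function.update i β k) c)
                - P.ν c * P.bmSharp vm (i β) c *
                    r (σ.lower β) (MovingSurface.omitAt β i) c)) := by
  refine ⟨fun σ i => ?_, fun I c hc => (P.bracketInv_bracket hc _ I).symm,
    fun σ i c hc => P.material_eq vm hc hr σ i⟩
  have hζν := P.contDiffOn_ζ.mul P.contDiffOn_ν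
  -- Smoothness is read off the explicit formula on the patch, so that the inverse spacetime metric
  -- need not be examined.
  refine ContDiffOn.congr ?_ fun c hc => P.material_eq vm hc hr σ i
  refine ((((MovingSurface.contDiffOn_pd P.isOpen_U (hr σ i) 0).add
    (P.contDiffOn_surfCovAlong hvm (hr σ) i)).add
    ((((contDiffOn_const.mul P.contDiffOn_ζ).mul P.contDiffOn_ν).mul
      (P.contDiffOn_dot hvm P.contDiffOn_ν)).mul (hr σ i))).add
    (hζν.mul (ContDiffOn.sum fun k _ => (P.contDiffOn_bm hvm k).mul
      (ContDiffOn.sum fun β _ => hr _ _)))).add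
    (ContDiffOn.sum fun β _ => (ContDiffOn.sum fun k _ => (P.contDiffOn_B _ _).mul (hr _ _)).sub
      ((P.contDiffOn_ν.mul (P.contDiffOn_bmSharp hvm _)).mul (hr _ _)))
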